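/- Let $(c_n)_{n\ge 1}$ be an unbounded increasing (not necessarily strictly) sequence in $(0,\infty)$. Let $d_n\in M_n=M_n(\mathbb C)$ be the diagonal matrix with $k$th diagonal entry $c_n^k$, $1\le k\le n$. Let $M=\oplus^\infty_n (M_n\oplus M_n)$ be the $C^*$-algebra of bounded sequences of pairs of matrices (operator norm on $M_n$, supremum norm on pairs and sequences), and let $N\subset M$ be the subalgebra of all tuples $((x_n, d_nx_nd_n^{-1}))_n$; its norm is $p((x_n))=\sup_n\max\{\|x_n\|,\|d_nx_nd_n^{-1}\|\}$. Let $L_n$ be the left shift on $\mathbb C^n$ ($L_ne_1=0$, $L_ne_j=e_{j-1}$ for $j\ge2$). For $n\ge k\ge 1$ let $E_{n,k}$ be the set of integers in $[\frac nk,\frac{2n}k]$ and $u_{n,k}=\frac1{|E_{n,k}|}\sum_{i\in E_{n,k}}L_n^i$; for $n<k$ let $u_{n,k}=I_n$. Put $u_k=(u_{n,k})_n$ and $$A=\{a\in N:\ p(au_k-a)+p(u_ka-a)\to0 \text{ as } k\to\infty\}.$$ Then $A$ is a norm-closed subalgebra of $M$ (hence an operator algebra), and: 1. for every $a\in A$ the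 spectrum of $a$ (computed in the algebra obtained from $A$ by adjoining an identity) is either finite, or consists of $0$ and the terms of a sequence of complex numbers converging to $0$; 2. $A$ is semisimple (its Jacobson radical is zero) and approximately unital (it has a two-sided contractive approximate identity); 3. $A$ is a modular annihilator algebra: it is semiprime, every maximal modular left ideal of $A$ has a nonzero right annihilator, and every maximal modular right ideal of $A$ has a nonzero left annihilator; 4. $A$ is not weakly compact: for some $a\in A$ the map $x\mapsto axa$ on $A$ is not a weakly compact operator. -/

import Mathlib

open Filter Topology
open scoped ENNReal Matrix.Norms.L2Operator

/-! ### Banach-algebra notions, for algebras that need not have an identity -/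

namespace BanachAlg

section Algebraic

variable {A : Type*} [NonUnitalRing A] [Module ℂ A]

/-- `J` is a left ideal of the algebra `A`. -/
def IsLeftIdeal (J : Submodule ℂ A) : Prop := ∀ a : A, ∀ x ∈ J, a * x ∈ J

/-- `J` is a right ideal of the algebra `A`. -/
def IsRightIdeal (J : Submodule ℂ A) : Prop := ∀ a : A, ∀ x ∈ J, x * a ∈ J

/-- `J` is a maximal modular left ideal: a proper left ideal, maximal among the proper left ideals,
for which some `e` is a right identity modulo `J`. -/
def IsMaxModularLeftIdeal (J : Submodule ℂ A) : Prop :=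
  IsLeftIdeal J ∧ J ≠ ⊤ ∧ (∀ K : Submodule ℂ A, IsLeftIdeal K → J < K → K = ⊤) ∧
    ∃ e : A, ∀ x : A, x - x * e ∈ J

/-- `J` is a maximal modular right ideal: a proper right ideal, maximal among the proper right
ideals, for which some `e` is a left identity modulo `J`. -/
def IsMaxModularRightIdeal (J : Submodule ℂ A) : Prop :=
  IsRightIdeal J ∧ J ≠ ⊤ ∧ (∀ K : Submodule ℂ A, IsRightIdeal K → J < K → K = ⊤) ∧
    ∃ e : A, ∀ x : A, x - e * x ∈ J

variable (A)

/-- `A` is semisimple: its Jacobson radical, the intersection of all maximal modular left ideals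
(which is `A` if there are none), is zero. -/
def IsSemisimple : Prop :=
  ∀ x : A, (∀ J : Submodule ℂ A, IsMaxModularLeftIdeal J → x ∈ J) → x = 0

/-- `A` is a modular annihilator algebra: it is semiprime, every maximal modular left ideal has a
nonzero right annihilator, and every maximal modular right ideal has a nonzero left annihilator. -/
def IsModularAnnihilator : Prop :=
  (∀ a : A, (∀ x : A, a * x * a = 0) → a = 0) ∧
  (∀ J : Submodule ℂ A, IsMaxModularLeftIdeal J → ∃ b : A, b ≠ 0 ∧ ∀ x ∈ J, x * b = 0) ∧
  (∀ J : Submodule ℂ A, IsMaxModularRightIdeal J → ∃ b : A, b ≠ 0 ∧ ∀ x ∈ J, b * x = 0)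

end Algebraic

section Normed

variable (A : Type*) [NonUnitalNormedRing A] [NormedSpace ℂ A]

/-- `A` has a contractive approximate identity (two-sided). The net is given as a filter. -/
def IsApproximatelyUnital : Prop :=
  ∃ l : Filter A, l.IsApproximateUnit ∧ ∀ᶠ e in l, ‖e‖ ≤ 1

/-- `A` is weakly compact: for every `a`, the map `x ↦ a x a` is a weakly compact operator, that is,
it takes the closed unit ball to a relatively weakly compact set. -/
def IsWeaklyCompact : Prop :=
  ∀ a : A, IsCompact (closure
    ((fun x : A => toWeakSpace ℂ A (a * x * a)) '' Metric.closedBall (0 : A) 1))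

end Normed

end BanachAlg

/-! ### The algebra -/

namespace ShiftAlg

/-- The `n × n` complex matrices, `n ≥ 1`, with the operator norm on the Hilbert space `ℂⁿ`. -/
abbrev Mat (n : ℕ+) : Type := Matrix (Fin n) (Fin n) ℂ

/-- The bounded sequences in `∏ₙ (Mₙ ⊕ Mₙ)`, a C⋆-algebra under the pointwise operations and the
supremum norm, with `‖(x, y)‖ = max ‖x‖ ‖y‖` on `Mₙ ⊕ Mₙ`. -/
abbrev M : Type := lp (fun n : ℕ+ => Mat n × Mat n) ∞

/-- The diagonal matrix `dₙ` with `k`-th diagonal entry `cₙ ^ k`, `1 ≤ k ≤ n`. -/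
noncomputable def d (c : ℕ+ → ℝ) (n : ℕ+) : Mat n :=
  Matrix.diagonal fun i : Fin n => (c n : ℂ) ^ ((i : ℕ) + 1)

/-- The left shift on `ℂⁿ`: `e₁ ↦ 0` and `eⱼ ↦ eⱼ₋₁` for `j ≥ 2`. -/
def shift (n : ℕ+) : Mat n :=
  Matrix.of fun i j : Fin n => if (i : ℕ) + 1 = (j : ℕ) then 1 else 0

/-- The set of integers in the interval `[n / k, 2 n / k]`. -/
def E (n k : ℕ+) : Finset ℕ :=
  Finset.Icc ⌈((n : ℕ) : ℚ) / ((k : ℕ) : ℚ)⌉₊ ⌊2 * ((n : ℕ) : ℚ) / ((k : ℕ) : ℚ)⌋₊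

/-- The matrix `uₙₖ`: the average of the powers of the left shift with exponents in `E n k` if
`k ≤ n`, and the identity matrix if `n < k`. -/
noncomputable def u (n k : ℕ+) : Mat n :=
  if k ≤ n then ((E n k).card : ℂ)⁻¹ • ∑ i ∈ E n k, shift n ^ i else 1

/-- The pair `(uₙₖ, dₙ uₙₖ dₙ⁻¹)`. -/
noncomputable def U (c : ℕ+ → ℝ) (k n : ℕ+) : Mat n × Mat n :=
  (u n k, d c n * u n k * (d c n)⁻¹)

/-- The supremum norm of a sequence of pairs of matrices, as an extended real. For a sequence of
the form `(xₙ, dₙ xₙ dₙ⁻¹)` it is `supₙ max (‖xₙ‖, ‖dₙ xₙ dₙ⁻¹‖)`. -/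
noncomputable def p (x : ∀ n : ℕ+, Mat n × Mat n) : ℝ≥0∞ := ⨆ n, ‖x n‖ₑ

theorem p_le_iff {x : ∀ n : ℕ+, Mat n × Mat n} {b : ℝ≥0∞} : p x ≤ b ↔ ∀ n, ‖x n‖ₑ ≤ b :=
  iSup_le_iff

theorem enorm_le_p (x : ∀ n : ℕ+, Mat n × Mat n) (n : ℕ+) : ‖x n‖ₑ ≤ p x :=
  le_iSup (fun n => ‖x n‖ₑ) n

theorem p_zero : p 0 = 0 := by simp [p]

theorem p_add_le (x y : ∀ n : ℕ+, Mat n × Mat n) : p (x + y) ≤ p x + p y :=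
  p_le_iff.2 fun n => (enorm_add_le _ _).trans (add_le_add (enorm_le_p x n) (enorm_le_p y n))

theorem enorm_mul_le_mul {n : ℕ+} (x y : Mat n × Mat n) : ‖x * y‖ₑ ≤ ‖x‖ₑ * ‖y‖ₑ := by
  simp only [enorm_eq_nnnorm]
  exact_mod_cast nnnorm_mul_le x y

theorem p_mul_le (x y : ∀ n : ℕ+, Mat n × Mat n) : p (x * y) ≤ p x * p y :=
  p_le_iff.2 fun n => (enorm_mul_le_mul _ _).trans (mul_le_mul' (enorm_le_p x n) (enorm_le_p y n))

theorem p_smul_le (r : ℂ) (x : ∀ n : ℕ+, Mat n × Mat n) : p (r • x) ≤ ‖r‖ₑ * p x :=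
  p_le_iff.2 fun n => by
    have h : ‖r • x n‖ₑ ≤ ‖r‖ₑ * ‖x n‖ₑ := by
      simp only [enorm_eq_nnnorm]
      exact_mod_cast nnnorm_smul_le r (x n)
    exact h.trans (mul_le_mul' le_rfl (enorm_le_p x n))

/-- On `M` the extended norm is the norm of `M`. -/
theorem p_coe (a : M) : p (fun n => a n) = ‖a‖ₑ := by
  apply le_antisymm
  · refine p_le_iff.2 fun n => ?_
    simp only [enorm_eq_nnnorm]
    exact_mod_cast lp.norm_apply_le_norm ENNReal.top_ne_zero a n
  · by_cases h : p (fun n => a n) = ∞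
    · rw [h]; exact le_top
    · rw [← ofReal_norm, ← ENNReal.ofReal_toReal h]
      refine ENNReal.ofReal_le_ofReal (lp.norm_le_of_forall_le ENNReal.toReal_nonneg fun n => ?_)
      rw [← toReal_enorm]
      exact ENNReal.toReal_mono h (enorm_le_p (fun n => a n) n)

theorem d_conj_mul (c : ℕ+ → ℝ) (n : ℕ+) (x y : Mat n) :
    d c n * (x * y) * (d c n)⁻¹ = (d c n * x * (d c n)⁻¹) * (d c n * y * (d c n)⁻¹) := by
  by_cases h : c n = 0
  · have h0 : d c n = 0 := by
      ext i j
      by_cases hij : i = j <;> simp [d, h, hij]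
    simp [h0]
  · have hu : IsUnit (d c n).det := by
      rw [d, Matrix.det_diagonal, isUnit_iff_ne_zero]
      exact Finset.prod_ne_zero_iff.2 fun i _ => pow_ne_zero _ (by exact_mod_cast h)
    have h1 : (d c n)⁻¹ * d c n = 1 := Matrix.nonsing_inv_mul _ hu
    calc d c n * (x * y) * (d c n)⁻¹
        = d c n * x * 1 * y * (d c n)⁻¹ := by simp only [mul_one, mul_assoc]
      _ = _ := by rw [← h1]; simp only [mul_assoc]

/-- The algebra of the bounded sequences of the form `(xₙ, dₙ xₙ dₙ⁻¹)`. -/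
noncomputable def N (c : ℕ+ → ℝ) : NonUnitalSubalgebra ℂ M where
  carrier := {a | ∀ n, (a n).2 = d c n * (a n).1 * (d c n)⁻¹}
  add_mem' {a b} ha hb n := by
    simp [ha n, hb n, mul_add, add_mul]
  zero_mem' n := by simp
  mul_mem' {a b} ha hb n := by
    simp only [lp.infty_coeFn_mul, Pi.mul_apply, Prod.snd_mul, Prod.fst_mul, ha n, hb n, d_conj_mul]
  smul_mem' r a ha n := by
    simp [lp.coeFn_smul, ha n]

/-- `p (a uₖ - a) + p (uₖ a - a)`. -/
noncomputable def defect (c : ℕ+ → ℝ) (a : M) (k : ℕ+) : ℝ≥0∞ :=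
  p (fun n => a n * U c k n - a n) + p (fun n => U c k n * a n - a n)

/-- The algebra of all `a ∈ N` such that `p (a uₖ - a) + p (uₖ a - a) → 0` as `k → ∞`. -/
noncomputable def A (c : ℕ+ → ℝ) : NonUnitalSubalgebra ℂ M where
  carrier := {a | a ∈ N c ∧ Tendsto (defect c a) atTop (𝓝 0)}
  add_mem' {a b} ha hb := by
    refine ⟨add_mem ha.1 hb.1, ?_⟩
    have h := ha.2.add hb.2
    rw [add_zero] at h
    refine tendsto_of_tendsto_of_tendsto_of_le_of_le tendsto_const_nhds h
      (fun k => zero_le) fun k => ?_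
    have e1 : (fun n => (a + b : M) n * U c k n - (a + b : M) n) =
        (fun n => a n * U c k n - a n) + fun n => b n * U c k n - b n := by
      funext n; simp only [lp.coeFn_add, Pi.add_apply, add_mul]; abel
    have e2 : (fun n => U c k n * (a + b : M) n - (a + b : M) n) =
        (fun n => U c k n * a n - a n) + fun n => U c k n * b n - b n := by
      funext n; simp only [lp.coeFn_add, Pi.add_apply, mul_add]; abel
    simp only [defect, e1, e2]
    refine (add_le_add (p_add_le _ _) (p_add_le _ _)).trans (le_of_eq ?_)
    abel
  zero_mem' := by
    refine ⟨zero_mem _, ?_⟩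
    have : defect c 0 = fun _ => 0 := by
      funext k; simp [defect, p]
    rw [this]; exact tendsto_const_nhds
  mul_mem' {a b} ha hb := by
    refine ⟨mul_mem ha.1 hb.1, ?_⟩
    have h1 := ENNReal.Tendsto.const_mul (a := ‖a‖ₑ) hb.2 (Or.inr enorm_ne_top)
    have h2 := ENNReal.Tendsto.const_mul (a := ‖b‖ₑ) ha.2 (Or.inr enorm_ne_top)
    have h := h1.add h2
    simp only [mul_zero, add_zero] at h
    refine tendsto_of_tendsto_of_tendsto_of_le_of_le tendsto_const_nhds h
      (fun k => zero_le) fun k => ?_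
    have e1 : (fun n => (a * b : M) n * U c k n - (a * b : M) n) =
        (fun n => a n) * fun n => b n * U c k n - b n := by
      funext n; simp only [lp.infty_coeFn_mul, Pi.mul_apply, mul_sub, mul_assoc]
    have e2 : (fun n => U c k n * (a * b : M) n - (a * b : M) n) =
        (fun n => U c k n * a n - a n) * fun n => b n := by
      funext n; simp only [lp.infty_coeFn_mul, Pi.mul_apply, sub_mul, mul_assoc]
    simp only [defect, e1, e2]
    refine add_le_add ((p_mul_le _ _).trans ?_) ((p_mul_le _ _).trans ?_)
    · rw [p_coe]; gcongr; exact le_self_add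
    · rw [p_coe, mul_comm]; gcongr; exact le_add_self
  smul_mem' r a ha := by
    refine ⟨SMulMemClass.smul_mem r ha.1, ?_⟩
    have h := ENNReal.Tendsto.const_mul (a := ‖r‖ₑ) ha.2 (Or.inr enorm_ne_top)
    rw [mul_zero] at h
    refine tendsto_of_tendsto_of_tendsto_of_le_of_le tendsto_const_nhds h
      (fun k => zero_le) fun k => ?_
    have e1 : (fun n => (r • a : M) n * U c k n - (r • a : M) n) =
        r • fun n => a n * U c k n - a n := by
      funext n; simp only [lp.coeFn_smul, Pi.smul_apply, smul_sub, smul_mul_assoc]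
    have e2 : (fun n => U c k n * (r • a : M) n - (r • a : M) n) =
        r • fun n => U c k n * a n - a n := by
      funext n; simp only [lp.coeFn_smul, Pi.smul_apply, smul_sub, mul_smul_comm]
    simp only [defect, e1, e2]
    rw [mul_add]
    exact add_le_add (p_smul_le _ _) (p_smul_le _ _)

noncomputable instance (c : ℕ+ → ℝ) : NormedSpace ℂ (A c) where
  norm_smul_le r x := norm_smul_le r (x : M)

end ShiftAlg

/-! An element `((xₙ, dₙ xₙ dₙ⁻¹))ₙ` of `A` has `‖dₙ xₙ dₙ⁻¹‖ → 0`, because `‖dₙ uₙₖ dₙ⁻¹‖ ≤ cₙ⁻¹`.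
Boundedness of `dₙ xₙ dₙ⁻¹` makes the part of `xₙ` below the diagonal small, by Schur's test, and
`uₖ a ≈ a` makes the upper triangular part of `xₙ` close to a strictly upper triangular matrix whose
`k`-th power vanishes. The inverses of `1 + xₙ` are therefore bounded for large `n`, so that `1 + a`
is invertible as soon as every `1 + xₙ` is. This locates the spectrum of `a` in the union of `{0}`
and the spectra of the `dₙ xₙ dₙ⁻¹`, whose radii tend to `0`. It also shows that `a` differs from a
quasiregular element by finitely many matrix blocks, hence that a proper modular one-sided ideal
misses some block; as the blocks are simple algebras, the annihilators can be found there.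

For weak compactness, let `qₛ` be the sum of the identities of the blocks `n ∈ s`. Every weak limit
point of `a qₛ a` is `a²`, which then is a norm limit of elements with finitely many blocks, so that
`‖xₙ²‖ → 0`. But `uₙₖ²` is an average of shifts by at most `4 n / k` places, hence `‖uₙₖ²‖ ≥ 1 / 2`
for `n ≥ k ≥ 8`. -/

section Filters

theorem cofinite_le_atTop {α : Type*} [LinearOrder α] [LocallyFiniteOrderBot α] :
    (cofinite : Filter α) ≤ atTop :=
  le_iInf fun a => le_principal_iff.2 <| mem_cofinite.2 <| (Set.finite_Iio a).subset fun _ hx =>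
    not_le.1 hx

theorem bddAbove_range_of_eventually_le {α β : Type*} [LinearOrder α] [LocallyFiniteOrderBot α]
    [Preorder β] [IsDirectedOrder β] {f : α → β} {C : β} (h : ∀ᶠ x in atTop, f x ≤ C) :
    BddAbove (Set.range f) :=
  IsBoundedUnder.bddAbove_range_of_cofinite ⟨C, cofinite_le_atTop h⟩

end Filters

section CountableSets

theorem finite_or_eq_insert_range_of_tendsto {X : Type*} [TopologicalSpace X]
    [FirstCountableTopology X] [T1Space X] {S : Set X} {x : X} (hx : x ∈ S)
    (hS : Tendsto ((↑) : S → X) cofinite (𝓝 x)) :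
    S.Finite ∨ ∃ l : ℕ → X, Tendsto l atTop (𝓝 x) ∧ S = insert x (Set.range l) := by
  refine S.finite_or_infinite.imp_right fun hinf => ?_
  have hcount : (Set.univ : Set S).Countable := by
    refine (hS.countable_compl_preimage_ker.insert ⟨x, hx⟩).mono fun y _ => ?_
    rw [ker_nhds]
    exact (em (y = ⟨x, hx⟩)).imp_right fun hne hyx => hne (Subtype.ext hyx)
  have : Countable S := Set.countable_univ_iff.1 hcount
  have : Infinite S := hinf.to_subtype
  obtain ⟨e⟩ : Nonempty (ℕ ≃ S) := nonempty_equiv_of_countable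
  refine ⟨fun i => e i, ?_, ?_⟩
  · rw [← Nat.cofinite_eq_atTop]
    exact hS.comp e.injective.tendsto_cofinite
  · rw [← Function.comp_def, e.surjective.range_comp, Subtype.range_coe, Set.insert_eq_of_mem hx]

end CountableSets

namespace BanachAlg

section BoundedUnits

variable {B : Type*} [NormedRing B]

/-- `x` is invertible and its inverse has norm at most `K`. -/
def IsUnitWithBound (K : ℝ) (x : B) : Prop := ∃ v : Bˣ, (v : B) = x ∧ ‖(↑v⁻¹ : B)‖ ≤ K

namespace IsUnitWithBound

variable {x y : B} {K L : ℝ}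

theorem mono (h : IsUnitWithBound K x) (hKL : K ≤ L) : IsUnitWithBound L x := by
  obtain ⟨v, hv, hvK⟩ := h
  exact ⟨v, hv, hvK.trans hKL⟩

theorem mul (hx : IsUnitWithBound K x) (hy : IsUnitWithBound L y) :
    IsUnitWithBound (L * K) (x * y) := by
  obtain ⟨v, rfl, hv⟩ := hx
  obtain ⟨w, rfl, hw⟩ := hy
  refine ⟨v * w, Units.val_mul v w, ?_⟩
  rw [mul_inv_rev, Units.val_mul]
  exact norm_mul_le_of_le hw hv

theorem prodMk {B' : Type*} [NormedRing B'] {y : B'} (hx : IsUnitWithBound K x)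
    (hy : IsUnitWithBound K y) : IsUnitWithBound K (x, y) := by
  obtain ⟨v, rfl, hv⟩ := hx
  obtain ⟨w, rfl, hw⟩ := hy
  exact ⟨MulEquiv.prodUnits.symm (v, w), rfl, norm_prod_le_iff.2 ⟨hv, hw⟩⟩

variable [NormOneClass B]

theorem one_add_of_norm_le_half [HasSummableGeomSeries B] (hx : ‖x‖ ≤ 1 / 2) :
    IsUnitWithBound 2 (1 + x) := by
  have hlt : ‖-x‖ < 1 := by rw [norm_neg]; linarith
  refine ⟨Units.oneSub (-x) hlt, by simp, ?_⟩
  calc ‖∑' i, (-x) ^ i‖ ≤ ‖(1 : B)‖ - 1 + (1 - ‖-x‖)⁻¹ := tsum_geometric_le_of_norm_lt_one _ hlt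
    _ = (1 - ‖x‖)⁻¹ := by rw [norm_one, norm_neg, sub_self, zero_add]
    _ ≤ 2 := inv_le_of_inv_le₀ two_pos (by linarith)

theorem one_add_of_pow_eq_zero {q : ℕ} {b : ℝ} (hx : x ^ q = 0) (hb : ‖x‖ ≤ b) :
    IsUnitWithBound (∑ i ∈ Finset.range q, b ^ i) (1 + x) := by
  have hneg : (-x) ^ q = 0 := by rw [neg_pow, hx, mul_zero]
  refine ⟨⟨1 + x, ∑ i ∈ Finset.range q, (-x) ^ i, ?_, ?_⟩, rfl, ?_⟩
  · rw [← sub_neg_eq_add, mul_neg_geom_sum, hneg, sub_zero]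
  · rw [← sub_neg_eq_add, geom_sum_mul_neg, hneg, sub_zero]
  · calc ‖∑ i ∈ Finset.range q, (-x) ^ i‖ ≤ ∑ i ∈ Finset.range q, ‖-x‖ ^ i :=
          norm_sum_le_of_le _ fun i _ => norm_pow_le _ i
      _ ≤ ∑ i ∈ Finset.range q, b ^ i := by rw [norm_neg]; gcongr

theorem add_of_mul_norm_le_half [HasSummableGeomSeries B] (hx : IsUnitWithBound K x)
    (hy : K * ‖y‖ ≤ 1 / 2) : IsUnitWithBound (2 * K) (x + y) := by
  obtain ⟨v, rfl, hv⟩ := hx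
  have hsmall : ‖↑v⁻¹ * y‖ ≤ 1 / 2 :=
    ((norm_mul_le _ _).trans (mul_le_mul_of_nonneg_right hv (norm_nonneg y))).trans hy
  have hfactor : (v : B) * (1 + ↑v⁻¹ * y) = v + y := by
    rw [mul_add, mul_one, Units.mul_inv_cancel_left]
  rw [← hfactor]
  exact mul ⟨v, rfl, hv⟩ (one_add_of_norm_le_half hsmall)

end IsUnitWithBound

theorem isUnit_lp_infty {ι : Type*} {B : ι → Type*} [∀ i, NormedRing (B i)]
    [∀ i, NormOneClass (B i)] {x : lp B ∞} {K : ℝ} (hx : ∀ i, IsUnit (x i))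
    (hK : ∀ᶠ i in cofinite, IsUnitWithBound K (x i)) : IsUnit x := by
  choose v hv using hx
  have hbdd : ∀ᶠ i in cofinite, ‖(v i)⁻¹.val‖ ≤ K := by
    filter_upwards [hK] with i ⟨w, hw, hwK⟩
    rwa [Units.ext ((hv i).trans hw.symm)]
  let y : lp B ∞ := ⟨fun i => (v i)⁻¹.val,
    memℓp_infty (IsBoundedUnder.bddAbove_range_of_cofinite ⟨K, hbdd⟩)⟩
  have hxy : x * y = 1 := lp.ext <| funext fun i => by
    rw [lp.infty_coeFn_mul, lp.infty_coeFn_one, Pi.mul_apply, ← hv i]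
    exact (v i).mul_inv
  have hyx : y * x = 1 := lp.ext <| funext fun i => by
    rw [lp.infty_coeFn_mul, lp.infty_coeFn_one, Pi.mul_apply, ← hv i]
    exact (v i).inv_mul
  exact ⟨⟨x, y, hxy, hyx⟩, rfl⟩

end BoundedUnits

section Powers

variable {B : Type*} [NormedRing B] [NormOneClass B] {w : B}

theorem norm_pow_le_one (hw : ‖w‖ ≤ 1) (i : ℕ) : ‖w ^ i‖ ≤ 1 :=
  (norm_pow_le w i).trans (pow_le_one₀ (norm_nonneg w) hw)

theorem norm_pow_mul_sub_le (hw : ‖w‖ ≤ 1) (z : B) (j : ℕ) : ‖w ^ j * z - z‖ ≤ j * ‖w * z - z‖ := by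
  induction j with
  | zero => simp
  | succ j ih =>
    calc ‖w ^ (j + 1) * z - z‖ = ‖w ^ j * (w * z - z) + (w ^ j * z - z)‖ := by
          rw [pow_succ]; noncomm_ring
      _ ≤ 1 * ‖w * z - z‖ + j * ‖w * z - z‖ :=
          norm_add_le_of_le (norm_mul_le_of_le (norm_pow_le_one hw j) le_rfl) ih
      _ = (j + 1 : ℕ) * ‖w * z - z‖ := by push_cast; ring

end Powers

section PowAvg

section Algebra

variable {B : Type*} [Ring B] [Algebra ℂ B]

/-- The average of the powers of `w` with exponents in `E` (zero if `E` is empty). -/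
noncomputable def powAvg (w : B) (E : Finset ℕ) : B := (E.card : ℂ)⁻¹ • ∑ i ∈ E, w ^ i

theorem commute_powAvg (w : B) (E F : Finset ℕ) : Commute (powAvg w E) (powAvg w F) :=
  Commute.smul_left (Commute.smul_right (Commute.sum_left _ _ _ fun i _ =>
    Commute.sum_right _ _ _ fun j _ => Commute.pow_pow_self w i j) _) _

theorem map_powAvg {B B' : Type*} [Ring B] [Algebra ℂ B] [Ring B'] [Algebra ℂ B']
    (f : B →ₐ[ℂ] B') (w : B) (F : Finset ℕ) : f (powAvg w F) = powAvg (f w) F := by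
  simp only [powAvg, map_smul, map_sum, map_pow]

theorem le_re_map_powAvg {B : Type*} [Ring B] [Algebra ℂ B] (φ : B →ₗ[ℂ] ℂ) {w : B}
    {F : Finset ℕ} (hF : F.Nonempty) {r : ℝ} (h : ∀ i ∈ F, r ≤ (φ (w ^ i)).re) :
    r ≤ (φ (powAvg w F)).re := by
  have hcard : (0 : ℝ) < F.card := Nat.cast_pos.2 hF.card_pos
  have hre : (φ (powAvg w F)).re = (F.card : ℝ)⁻¹ * ∑ i ∈ F, (φ (w ^ i)).re := by
    rw [powAvg, map_smul, map_sum, smul_eq_mul, ← Complex.ofReal_natCast, ← Complex.ofReal_inv,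
      Complex.re_ofReal_mul, Complex.re_sum]
  rw [hre, le_inv_mul_iff₀ hcard, ← nsmul_eq_mul]
  exact F.card_nsmul_le_sum _ r h

end Algebra

variable {B : Type*} [NormedRing B] [NormedAlgebra ℂ B] {w z : B} {E F : Finset ℕ} {b : ℝ}

theorem norm_inv_card_smul_sum_le {ι : Type*} {s : Finset ι} (hs : s.Nonempty) {f : ι → B}
    (h : ∀ i ∈ s, ‖f i‖ ≤ b) : ‖(s.card : ℂ)⁻¹ • ∑ i ∈ s, f i‖ ≤ b := by
  have hcard : (0 : ℝ) < s.card := by exact_mod_cast hs.card_pos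
  rw [norm_smul, norm_inv, Complex.norm_natCast, inv_mul_le_iff₀ hcard, ← nsmul_eq_mul]
  exact (norm_sum_le _ _).trans (Finset.sum_le_card_nsmul _ _ b h)

theorem norm_powAvg_le (hE : E.Nonempty) (h : ∀ i ∈ E, ‖w ^ i‖ ≤ b) : ‖powAvg w E‖ ≤ b :=
  norm_inv_card_smul_sum_le hE h

theorem norm_powAvg_mul_sub_le (hE : E.Nonempty) (h : ∀ i ∈ E, ‖w ^ i * z - z‖ ≤ b) :
    ‖powAvg w E * z - z‖ ≤ b := by
  have hcard : (E.card : ℂ) ≠ 0 := by exact_mod_cast hE.card_pos.ne'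
  have hsum : powAvg w E * z - z = (E.card : ℂ)⁻¹ • ∑ i ∈ E, (w ^ i * z - z) := by
    rw [powAvg, Finset.sum_sub_distrib, smul_sub, Finset.sum_const, ← Nat.cast_smul_eq_nsmul ℂ,
      inv_smul_smul₀ hcard, smul_mul_assoc, Finset.sum_mul]
  rw [hsum]
  exact norm_inv_card_smul_sum_le hE h

variable [NormOneClass B]

theorem norm_mul_powAvg_Icc_sub_le (hw : ‖w‖ ≤ 1) {a b : ℕ} (hab : a ≤ b) :
    ‖w * powAvg w (Finset.Icc a b) - powAvg w (Finset.Icc a b)‖ ≤ 2 / (Finset.Icc a b).card := by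
  have htelescope :
      w * ∑ i ∈ Finset.Icc a b, w ^ i - ∑ i ∈ Finset.Icc a b, w ^ i = w ^ (b + 1) - w ^ a := by
    rw [Finset.mul_sum, ← Finset.sum_sub_distrib, ← Finset.Ico_add_one_right_eq_Icc]
    simp_rw [← pow_succ']
    exact Finset.sum_Ico_sub (fun i => w ^ i) (by omega)
  rw [powAvg, mul_smul_comm, ← smul_sub, htelescope, norm_smul, norm_inv, Complex.norm_natCast,
    inv_mul_eq_div]
  gcongr
  exact (norm_sub_le_of_le (norm_pow_le_one hw _) (norm_pow_le_one hw _)).trans_eq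
    one_add_one_eq_two

theorem norm_powAvg_mul_powAvg_Icc_sub_le (hw : ‖w‖ ≤ 1) (hF : F.Nonempty) {m : ℝ}
    (hm : ∀ i ∈ F, (i : ℝ) ≤ m) {a b : ℕ} (hab : a ≤ b) :
    ‖powAvg w F * powAvg w (Finset.Icc a b) - powAvg w (Finset.Icc a b)‖ ≤
      m * (2 / (Finset.Icc a b).card) :=
  norm_powAvg_mul_sub_le hF fun i hi => (norm_pow_mul_sub_le hw _ i).trans <|
    mul_le_mul (hm i hi) (norm_mul_powAvg_Icc_sub_le hw hab) (norm_nonneg _)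
      ((Nat.cast_nonneg i).trans (hm i hi))

end PowAvg

section ApproximateUnits

theorem isClosed_setOf_tendsto_mul {B ι : Type*} [NonUnitalNormedRing B] {l : Filter ι} {v : ι → B}
    (hv : BddAbove (Set.range fun k => ‖v k‖)) :
    IsClosed {a | Tendsto (fun k => v k * a) l (𝓝 a) ∧ Tendsto (fun k => a * v k) l (𝓝 a)} := by
  obtain ⟨K, hK⟩ := hv
  have hvK (k : ι) : ‖v k‖ ≤ K := hK ⟨k, rfl⟩
  refine IsClosed.and ?_ ?_
  all_goals
    refine (LipschitzWith.uniformEquicontinuous _ K.toNNReal fun k => .of_dist_le' fun a b => ?_)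
      |>.equicontinuous.isClosed_setOfPred_tendsto continuous_id
  · rw [dist_eq_norm, dist_eq_norm, ← mul_sub]
    exact norm_mul_le_of_le (hvK k) le_rfl
  · rw [dist_eq_norm, dist_eq_norm, ← sub_mul, mul_comm K]
    exact norm_mul_le_of_le le_rfl (hvK k)

theorem isApproximatelyUnital_of_tendsto {B ι : Type*} [NonUnitalNormedRing B] [NormedSpace ℂ B]
    {l : Filter ι} [l.NeBot] {v : ι → B} (hv : ∀ᶠ k in l, ‖v k‖ ≤ 1)
    (hleft : ∀ a, Tendsto (fun k => v k * a) l (𝓝 a))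
    (hright : ∀ a, Tendsto (fun k => a * v k) l (𝓝 a)) : IsApproximatelyUnital B :=
  ⟨l.map v, { tendsto_mul_left := hright, tendsto_mul_right := hleft }, hv⟩

end ApproximateUnits

section Quasiregular

theorem isQuasiregular_of_units_inv_mul_mem {B σ : Type*} [Ring B] [SetLike σ B]
    [NonUnitalSubringClass σ B] {S : σ} {a : S} {v : Bˣ} (hv : v.val = 1 + a)
    (h : v⁻¹.val * a ∈ S) : IsQuasiregular a := by
  have hright : (a : B) - (1 + a) * (v⁻¹.val * a) = 0 := by
    rw [← hv, v.mul_inv_cancel_left, sub_self]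
  have hleft : (a : B) - v⁻¹.val * ((1 + a) * a) = 0 := by
    rw [← hv, v.inv_mul_cancel_left, sub_self]
  refine isQuasiregular_iff.2 ⟨-⟨_, h⟩, Subtype.ext ?_, Subtype.ext ?_⟩
  · rw [ZeroMemClass.coe_zero, ← hright]
    change -(v⁻¹.val * (a : B)) + a + a * -(v⁻¹.val * a) = _
    noncomm_ring
  · rw [ZeroMemClass.coe_zero, ← hleft]
    change (a : B) + -(v⁻¹.val * a) + -(v⁻¹.val * a) * a = _
    noncomm_ring

theorem isQuasiregular_op {B : Type*} [NonUnitalRing B] {x : B} (hx : IsQuasiregular x) :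
    IsQuasiregular (MulOpposite.op x) := by
  obtain ⟨y, hy, hy'⟩ := isQuasiregular_iff.1 hx
  refine isQuasiregular_iff.2 ⟨.op y, ?_, ?_⟩
  · rw [← MulOpposite.op_mul, ← MulOpposite.op_add, ← MulOpposite.op_add, add_comm y, hy',
      MulOpposite.op_zero]
  · rw [← MulOpposite.op_mul, ← MulOpposite.op_add, ← MulOpposite.op_add, add_comm x, hy,
      MulOpposite.op_zero]

end Quasiregular

section SemisimpleRing

variable {R : Type*} [Ring R] [IsSemisimpleRing R]

theorem eq_zero_of_forall_mul_mul_eq_zero {a : R} (h : ∀ r, a * r * a = 0) : a = 0 := by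
  obtain ⟨e, he, hspan⟩ := IsSemisimpleRing.ideal_eq_span_idempotent (Ideal.span {a})
  obtain ⟨s, rfl⟩ := Ideal.mem_span_singleton'.1 (hspan ▸ Ideal.mem_span_singleton_self a)
  obtain ⟨r, hr⟩ := Ideal.mem_span_singleton'.1 (hspan.symm ▸ Ideal.mem_span_singleton_self e)
  have := h r
  rwa [mul_assoc, hr, mul_assoc, he.eq] at this

theorem exists_ne_zero_forall_mul_eq_zero {I : Ideal R} (hI : I ≠ ⊤) :
    ∃ b ≠ 0, ∀ x ∈ I, x * b = 0 := by
  obtain ⟨e, he, rfl⟩ := IsSemisimpleRing.ideal_eq_span_idempotent I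
  refine ⟨1 - e, fun h => hI ?_, fun x hx => ?_⟩
  · rw [← sub_eq_zero.1 h, Ideal.span_singleton_one]
  · obtain ⟨y, rfl⟩ := Ideal.mem_span_singleton'.1 hx
    rw [mul_assoc, he.mul_one_sub_self, mul_zero]

end SemisimpleRing

section OneSidedIdeals

variable {B : Type*} [NonUnitalRing B] [Module ℂ B] {J : Submodule ℂ B}

theorem IsLeftIdeal.eq_top_of_mem (hJ : IsLeftIdeal J) {e : B} (he : ∀ x, x - x * e ∈ J)
    (h : e ∈ J) : J = ⊤ :=
  eq_top_iff.2 fun x _ => (J.sub_mem_iff_left (hJ x e h)).1 (he x)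

theorem IsRightIdeal.op (hJ : IsRightIdeal J) :
    IsLeftIdeal (J.comap (MulOpposite.opLinearEquiv ℂ (M := B)).symm.toLinearMap) :=
  fun a x hx => hJ a.unop x.unop hx

end OneSidedIdeals

/-- A presentation of `B` as an algebra of families in the product of the algebras `R i` which
contains all finitely supported families: `coord i` is the `i`-th coordinate, and `block i` inserts
an element of `R i` as a family supported at `i`. -/
structure BlockSystem {ι : Type*} [DecidableEq ι] (R : ι → Type*) [∀ i, Ring (R i)]
    [∀ i, Algebra ℂ (R i)] (B : Type*) [NonUnitalRing B] [Module ℂ B] where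
  coord : ∀ i, B →ₙₐ[ℂ] R i
  block : ∀ i, R i → B
  coord_block : ∀ i x j, coord j (block i x) = Pi.single i x j
  ext : ∀ a b, (∀ i, coord i a = coord i b) → a = b

namespace BlockSystem

variable {ι : Type*} [DecidableEq ι] {R : ι → Type*} [∀ i, Ring (R i)] [∀ i, Algebra ℂ (R i)]
  {B : Type*} [NonUnitalRing B] [Module ℂ B] (S : BlockSystem R B) {J K : Submodule ℂ B}

theorem coord_block_self (i : ι) (x : R i) : S.coord i (S.block i x) = x := by
  rw [S.coord_block, Pi.single_eq_same]

theorem block_zero (i : ι) : S.block i 0 = 0 :=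
  S.ext _ _ fun j => by rw [S.coord_block, Pi.single_zero, Pi.zero_apply, map_zero]

theorem block_add (i : ι) (x y : R i) : S.block i (x + y) = S.block i x + S.block i y :=
  S.ext _ _ fun j => by
    rw [map_add, S.coord_block, S.coord_block, S.coord_block, Pi.single_add, Pi.add_apply]

theorem mul_block (a : B) (i : ι) (x : R i) : a * S.block i x = S.block i (S.coord i a * x) :=
  S.ext _ _ fun j => by
    rw [map_mul, S.coord_block, S.coord_block]
    obtain rfl | hij := eq_or_ne j i
    · rw [Pi.single_eq_same, Pi.single_eq_same]
    · rw [Pi.single_eq_of_ne hij, Pi.single_eq_of_ne hij, mul_zero]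

theorem block_mul (i : ι) (x : R i) (a : B) : S.block i x * a = S.block i (x * S.coord i a) :=
  S.ext _ _ fun j => by
    rw [map_mul, S.coord_block, S.coord_block]
    obtain rfl | hij := eq_or_ne j i
    · rw [Pi.single_eq_same, Pi.single_eq_same]
    · rw [Pi.single_eq_of_ne hij, Pi.single_eq_of_ne hij, zero_mul]

theorem coord_sum_block (s : Finset ι) (f : ∀ i, R i) (i : ι) :
    S.coord i (∑ j ∈ s, S.block j (f j)) = if i ∈ s then f i else 0 := by
  rw [map_sum]
  split_ifs with hi
  · rw [Finset.sum_eq_single_of_mem i hi fun j _ hj => by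
      rw [S.coord_block, Pi.single_eq_of_ne hj.symm], S.coord_block_self]
  · exact Finset.sum_eq_zero fun j hj => by
      rw [S.coord_block, Pi.single_eq_of_ne (ne_of_mem_of_not_mem hj hi).symm]

theorem coord_sub_sum_block (s : Finset ι) (a : B) (i : ι) :
    S.coord i (a - ∑ j ∈ s, S.block j (S.coord j a)) = if i ∈ s then 0 else S.coord i a := by
  rw [map_sub, S.coord_sum_block]
  split_ifs
  · exact sub_self _
  · exact sub_zero _

/-- The block system on the opposite algebras, which exchanges left and right ideals. -/
def op : BlockSystem (fun i => (R i)ᵐᵒᵖ) Bᵐᵒᵖ where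
  coord i :=
    { toFun := fun a => .op (S.coord i a.unop)
      map_smul' := fun r a => congr_arg MulOpposite.op (map_smul (S.coord i) r a.unop)
      map_zero' := congr_arg MulOpposite.op (map_zero (S.coord i))
      map_add' := fun a b => congr_arg MulOpposite.op (map_add (S.coord i) a.unop b.unop)
      map_mul' := fun a b => congr_arg MulOpposite.op (map_mul (S.coord i) b.unop a.unop) }
  block i x := .op (S.block i x.unop)
  coord_block i x j := by
    refine (congr_arg MulOpposite.op (S.coord_block i x.unop j)).trans ?_
    exact Pi.apply_single (fun i => MulOpposite.op (α := R i)) (fun _ => rfl) i x.unop j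
  ext a b h := MulOpposite.unop_injective <|
    S.ext _ _ fun i => MulOpposite.op_injective (h i)

/-- The left ideal of all elements of `R i` whose insertion in `B` lies in the left ideal `J`. -/
def blockIdeal (hJ : IsLeftIdeal J) (i : ι) : Ideal (R i) where
  carrier := {x | S.block i x ∈ J}
  zero_mem' := by rw [Set.mem_ofPred_eq, S.block_zero]; exact J.zero_mem
  add_mem' hx hy := by rw [Set.mem_ofPred_eq, S.block_add]; exact J.add_mem hx hy
  smul_mem' r x hx := by
    have := hJ (S.block i r) _ hx
    rwa [S.block_mul, S.coord_block_self] at this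

theorem coord_mem_blockIdeal (hJ : IsLeftIdeal J) (i : ι) {x : B} (hx : x ∈ J) :
    S.coord i x ∈ S.blockIdeal hJ i := by
  have := hJ (S.block i 1) x hx
  rwa [S.block_mul, one_mul] at this

theorem isMaxModularLeftIdeal_comap (i : ι) {I : Ideal (R i)} (hI : I.IsMaximal) :
    IsMaxModularLeftIdeal ((I.restrictScalars ℂ).comap (S.coord i : B →ₗ[ℂ] R i)) := by
  have hmodular : ∀ x, x - x * S.block i 1 ∈
      (I.restrictScalars ℂ).comap (S.coord i : B →ₗ[ℂ] R i) := fun x => by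
    change S.coord i (x - x * S.block i 1) ∈ I
    rw [map_sub, map_mul, S.coord_block_self, mul_one, sub_self]
    exact I.zero_mem
  refine ⟨fun a x hx => ?_, fun htop => ?_, fun K hK hlt => ?_, _, hmodular⟩
  · change S.coord i (a * x) ∈ I
    rw [map_mul]
    exact I.mul_mem_left _ hx
  · have hone : S.coord i (S.block i 1) ∈ I :=
      (htop ▸ Submodule.mem_top :
        S.block i 1 ∈ (I.restrictScalars ℂ).comap (S.coord i : B →ₗ[ℂ] R i))
    rw [S.coord_block_self] at hone
    exact hI.ne_top (I.eq_top_of_isUnit_mem hone isUnit_one)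
  · obtain ⟨hle, y, hyK, hyI⟩ := SetLike.lt_iff_le_and_exists.1 hlt
    have hsub : I < S.blockIdeal hK i := by
      refine SetLike.lt_iff_le_and_exists.2
        ⟨fun x hx => hle ?_, S.coord i y, S.coord_mem_blockIdeal hK i hyK, hyI⟩
      change S.coord i (S.block i x) ∈ I
      rwa [S.coord_block_self]
    have hone : (1 : R i) ∈ S.blockIdeal hK i := hI.1.2 _ hsub ▸ Submodule.mem_top
    exact hK.eq_top_of_mem (fun x => hle (hmodular x)) hone

/-- Every element of the algebra is the sum of a finitely supported family and a quasiregular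
element, its tail outside a finite set of coordinates. -/
def QuasiregularTails : Prop :=
  ∀ a : B, ∃ s : Finset ι, IsQuasiregular (a - ∑ i ∈ s, S.block i (S.coord i a))

variable {S}

theorem QuasiregularTails.op (hS : S.QuasiregularTails) : S.op.QuasiregularTails := fun a => by
  obtain ⟨s, hs⟩ := hS a.unop
  refine ⟨s, ?_⟩
  have hsum : a - ∑ i ∈ s, S.op.block i (S.op.coord i a) =
      .op (a.unop - ∑ i ∈ s, S.block i (S.coord i a.unop)) := by
    rw [MulOpposite.op_sub, Finset.op_sum, MulOpposite.op_unop]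
    rfl
  exact hsum ▸ isQuasiregular_op hs

theorem QuasiregularTails.exists_block_notMem (hS : S.QuasiregularTails) (hJ : IsLeftIdeal J)
    (hne : J ≠ ⊤) {e : B} (he : ∀ x, x - x * e ∈ J) : ∃ i x, S.block i x ∉ J := by
  by_contra! hall
  obtain ⟨s, hs⟩ := hS (-e)
  obtain ⟨y, -, hy⟩ := isQuasiregular_iff.1 hs
  set f := ∑ i ∈ s, S.block i (S.coord i (-e))
  have hf : f ∈ J := J.sum_mem fun i _ => hall i _
  have heq : e = y - y * e - (y * f + f) := by
    rw [← sub_eq_zero, ← neg_eq_zero, ← hy]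
    noncomm_ring
  refine hne (hJ.eq_top_of_mem he ?_)
  rw [heq]
  exact J.sub_mem (he y) (J.add_mem (hJ y f hf) hf)

section IsSemisimpleRing

variable [∀ i, IsSemisimpleRing (R i)]

theorem isSemisimple (S : BlockSystem R B) : IsSemisimple B := fun x hx => by
  refine S.ext x 0 fun i => ?_
  rw [map_zero, ← Ideal.mem_bot, ← IsSemisimpleRing.jacobson_eq_bot (R i),
    Ring.jacobson_eq_sInf_isMaximal]
  exact Submodule.mem_sInf.2 fun I hI => hx _ (S.isMaxModularLeftIdeal_comap i hI)

theorem eq_zero_of_forall_mul_mul_eq_zero (S : BlockSystem R B) {a : B}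
    (ha : ∀ x, a * x * a = 0) : a = 0 :=
  S.ext a 0 fun i => (BanachAlg.eq_zero_of_forall_mul_mul_eq_zero fun r => by
    rw [← S.coord_block_self i r, ← map_mul, ← map_mul, ha, map_zero]).trans (map_zero _).symm

theorem QuasiregularTails.exists_right_annihilator (hS : S.QuasiregularTails)
    (hJ : IsLeftIdeal J) (hne : J ≠ ⊤) {e : B} (he : ∀ x, x - x * e ∈ J) :
    ∃ b : B, b ≠ 0 ∧ ∀ x ∈ J, x * b = 0 := by
  obtain ⟨i, y, hy⟩ := hS.exists_block_notMem hJ hne he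
  obtain ⟨b, hb, hbI⟩ := exists_ne_zero_forall_mul_eq_zero
    (I := S.blockIdeal hJ i) fun htop => hy (htop ▸ Submodule.mem_top : y ∈ S.blockIdeal hJ i)
  refine ⟨S.block i b, fun hzero => hb ?_, fun x hx => ?_⟩
  · rw [← S.coord_block_self i b, hzero, map_zero]
  · rw [S.mul_block, hbI _ (S.coord_mem_blockIdeal hJ i hx), S.block_zero]

theorem QuasiregularTails.isModularAnnihilator (hS : S.QuasiregularTails) :
    IsModularAnnihilator B := by
  refine ⟨fun _ => S.eq_zero_of_forall_mul_mul_eq_zero,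
    fun J ⟨hJ, hne, _, e, he⟩ => hS.exists_right_annihilator hJ hne he,
    fun J ⟨hJ, hne, _, e, he⟩ => ?_⟩
  obtain ⟨b, hb, hbJ⟩ := hS.op.exists_right_annihilator (e := .op e) hJ.op
    (fun htop => hne (eq_top_iff.2 fun x _ => by
      exact (htop ▸ Submodule.mem_top : MulOpposite.op x ∈ J.comap
        (MulOpposite.opLinearEquiv ℂ (M := B)).symm.toLinearMap)))
    fun x => he x.unop
  exact ⟨b.unop, (MulOpposite.unop_ne_zero_iff b).2 hb,
    fun x hx => MulOpposite.op_injective (hbJ (.op x) hx)⟩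

end IsSemisimpleRing

end BlockSystem

theorem IsWeaklyCompact.mem_closure {B : Type*} [NonUnitalNormedRing B] [NormedSpace ℂ B]
    (hB : IsWeaklyCompact B) {ι : Type*} {F : ι → Type*} [∀ i, NormedAddCommGroup (F i)]
    [∀ i, NormedSpace ℂ (F i)] {π : ∀ i, B →L[ℂ] F i} (hπ : ∀ x y, (∀ i, π i x = π i y) → x = y)
    {κ : Type*} {l : Filter κ} [l.NeBot] {q : κ → B} (hq : ∀ m, ‖q m‖ ≤ 1) {a b : B}
    (hlim : ∀ i, ∀ᶠ m in l, π i (a * q m * a) = π i b) {V : Submodule ℂ B}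
    (hV : ∀ m, a * q m * a ∈ V) : b ∈ closure (V : Set B) := by
  let z : κ → WeakSpace ℂ B := fun m => toWeakSpace ℂ B (a * q m * a)
  obtain ⟨w, -, hw⟩ := (hB a).exists_mapClusterPt (f := l) (u := z) <|
    tendsto_principal.2 <| Eventually.of_forall fun m =>
      subset_closure ⟨q m, mem_closedBall_zero_iff.2 (hq m), rfl⟩
  have hwb : w = toWeakSpace ℂ B b := by
    refine (toWeakSpace ℂ B).symm.injective (hπ _ _ fun i => ?_)
    refine (toWeakSpace ℂ (F i)).injective ?_
    have hclus := hw.continuousAt_comp (WeakSpace.map (π i)).continuous.continuousAt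
    have hconst : Tendsto (WeakSpace.map (π i) ∘ z) l (𝓝 (toWeakSpace ℂ (F i) (π i b))) :=
      tendsto_const_nhds.congr' ((hlim i).mono fun m hm => congr_arg (toWeakSpace ℂ (F i)) hm.symm)
    exact eq_of_nhds_neBot (ClusterPt.mono hclus hconst)
  have hwV : w ∈ closure (toWeakSpace ℂ B '' V) :=
    mem_closure_iff_clusterPt.2 <| ClusterPt.mono hw <|
      tendsto_principal.2 <| Eventually.of_forall fun m => Set.mem_image_of_mem _ (hV m)
  have hconvex : Convex ℝ (V : Set B) := (V.restrictScalars ℝ).convex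
  rw [← hconvex.toWeakSpace_closure ℂ, hwb] at hwV
  exact (toWeakSpace ℂ B).injective.mem_set_image.1 hwV

namespace BlockSystem

variable {ι : Type*} [DecidableEq ι] {R : ι → Type*} [∀ i, NormedRing (R i)]
  [∀ i, NormedAlgebra ℂ (R i)] {B : Type*} [NonUnitalNormedRing B] [NormedSpace ℂ B]
  (S : BlockSystem R B)

/-- The subspace of all elements with finitely many nonzero coordinates. -/
def finitelySupported : Submodule ℂ B where
  carrier := {b | ∀ᶠ i in cofinite, S.coord i b = 0}
  zero_mem' := by simp
  add_mem' {a b} (ha : ∀ᶠ i in cofinite, S.coord i a = 0)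
      (hb : ∀ᶠ i in cofinite, S.coord i b = 0) := by
    change ∀ᶠ i in cofinite, S.coord i (a + b) = 0
    filter_upwards [ha, hb] with i hai hbi
    rw [map_add, hai, hbi, add_zero]
  smul_mem' r a (ha : ∀ᶠ i in cofinite, S.coord i a = 0) := by
    change ∀ᶠ i in cofinite, S.coord i (r • a) = 0
    filter_upwards [ha] with i hai
    rw [map_smul, hai, smul_zero]

variable {S}

theorem tendsto_norm_coord_mul_self (hB : IsWeaklyCompact B)
    (hcoord : ∀ i b, ‖S.coord i b‖ ≤ ‖b‖) (hone : ∀ s, ‖∑ i ∈ s, S.block i 1‖ ≤ 1) (a : B) :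
    Tendsto (fun i => ‖S.coord i a * S.coord i a‖) cofinite (𝓝 0) := by
  have hclosure : a * a ∈ closure (S.finitelySupported : Set B) := by
    refine hB.mem_closure (l := atTop) (a := a)
      (π := fun i => (S.coord i : B →ₗ[ℂ] R i).mkContinuous 1 fun b => by
        rw [one_mul]; exact hcoord i b)
      S.ext hone (fun i => ?_) fun s => ?_
    · filter_upwards [eventually_ge_atTop {i}] with s hs
      change S.coord i _ = S.coord i _
      rw [map_mul, map_mul, map_mul, S.coord_sum_block, if_pos (hs (Finset.mem_singleton_self i)),
        mul_one]
    · filter_upwards [s.eventually_cofinite_notMem] with i hi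
      rw [map_mul, map_mul, S.coord_sum_block, if_neg hi, mul_zero, zero_mul]
  refine Metric.tendsto_nhds.2 fun ε hε => ?_
  obtain ⟨x, hx, hdist⟩ := Metric.mem_closure_iff.1 hclosure ε hε
  filter_upwards [hx] with i hxi
  calc dist ‖S.coord i a * S.coord i a‖ 0 = ‖S.coord i (a * a - x)‖ := by
        rw [dist_zero_right, norm_norm, map_sub, hxi, sub_zero, map_mul]
    _ ≤ ‖a * a - x‖ := hcoord i _
    _ < ε := by rwa [← dist_eq_norm]

end BlockSystem

end BanachAlg

namespace ShiftAlg

open BanachAlg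

section SchurTest

variable {m n 𝕜 : Type*} [Fintype n] [RCLike 𝕜] {X : Matrix m n 𝕜} {r s : ℝ}

theorem sq_norm_mulVec_apply_le (hrow : ∀ i, ∑ j, ‖X i j‖ ≤ r) (v : n → 𝕜) (i : m) :
    ‖(X.mulVec v) i‖ ^ 2 ≤ r * ∑ j, ‖X i j‖ * ‖v j‖ ^ 2 := by
  calc ‖(X.mulVec v) i‖ ^ 2 ≤ (∑ j, ‖X i j‖ * ‖v j‖) ^ 2 := by
        gcongr
        exact norm_sum_le_of_le _ fun j _ => (norm_mul _ _).le
    _ ≤ (∑ j, ‖X i j‖) * ∑ j, ‖X i j‖ * ‖v j‖ ^ 2 :=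
        Finset.sum_sq_le_sum_mul_sum_of_sq_le_mul _ (fun j _ => norm_nonneg _)
          (fun j _ => by positivity) fun j _ => by
          rw [mul_pow, sq ‖X i j‖, mul_assoc]
    _ ≤ r * ∑ j, ‖X i j‖ * ‖v j‖ ^ 2 := by gcongr; exact hrow i

theorem l2_opNorm_le_sqrt_mul [Fintype m] [DecidableEq n] (hr : 0 ≤ r)
    (hrow : ∀ i, ∑ j, ‖X i j‖ ≤ r) (hcol : ∀ j, ∑ i, ‖X i j‖ ≤ s) : ‖X‖ ≤ √(r * s) := by
  rw [Matrix.l2_opNorm_def]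
  refine ContinuousLinearMap.opNorm_le_bound _ (Real.sqrt_nonneg _) fun v => ?_
  rw [← Real.sqrt_sq (norm_nonneg v), ← Real.sqrt_mul' _ (sq_nonneg _)]
  refine Real.le_sqrt_of_sq_le ?_
  rw [EuclideanSpace.norm_sq_eq, EuclideanSpace.norm_sq_eq]
  calc ∑ i, ‖(X.mulVec v.ofLp) i‖ ^ 2 ≤ ∑ i, r * ∑ j, ‖X i j‖ * ‖v j‖ ^ 2 :=
        Finset.sum_le_sum fun i _ => sq_norm_mulVec_apply_le hrow _ i
    _ = r * ∑ j, (∑ i, ‖X i j‖) * ‖v j‖ ^ 2 := by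
        rw [← Finset.mul_sum, Finset.sum_comm]
        simp only [Finset.sum_mul]
    _ ≤ r * ∑ j, s * ‖v j‖ ^ 2 := by
        gcongr with j
        exact hcol j
    _ = r * s * ∑ j, ‖v j‖ ^ 2 := by rw [← Finset.mul_sum, mul_assoc]

end SchurTest

section Entries

variable {m n 𝕜 : Type*} [Fintype m] [Fintype n] [DecidableEq n] [RCLike 𝕜]

theorem norm_entry_le (X : Matrix m n 𝕜) (i : m) (j : n) : ‖X i j‖ ≤ ‖X‖ := by
  have h := X.l2_opNorm_mulVec (EuclideanSpace.single j 1)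
  rw [PiLp.norm_single, norm_one, mul_one] at h
  refine le_trans (le_of_eq ?_) ((PiLp.norm_apply_le _ i).trans h)
  simp

theorem norm_sum_entries_le (X : Matrix n n 𝕜) : ‖∑ i, ∑ j, X i j‖ ≤ Fintype.card n * ‖X‖ := by
  let v : EuclideanSpace 𝕜 n := WithLp.toLp 2 fun _ => 1
  have hv : ‖v‖ * ‖v‖ = Fintype.card n := by
    rw [← sq, EuclideanSpace.norm_sq_eq]
    simp [v]
  have hsum : inner 𝕜 v (WithLp.toLp 2 (X.mulVec v)) = ∑ i, ∑ j, X i j := by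
    simp [PiLp.inner_apply, Matrix.mulVec, dotProduct, v]
  calc ‖∑ i, ∑ j, X i j‖ ≤ ‖v‖ * ‖WithLp.toLp 2 (X.mulVec v)‖ :=
        hsum ▸ norm_inner_le_norm _ _
    _ ≤ ‖v‖ * (‖X‖ * ‖v‖) := by gcongr; exact X.l2_opNorm_mulVec v
    _ = Fintype.card n * ‖X‖ := by rw [← hv]; ring

end Entries

section UpperBand

variable (R : Type*) [Semiring R] {n m m' : ℕ}

/-- The matrices that vanish below the `m`-th superdiagonal; for `m = 0` these are the upper
triangular matrices. -/
def upperBand (n m : ℕ) : Submodule R (Matrix (Fin n) (Fin n) R) where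
  carrier := {X | ∀ i j : Fin n, (j : ℕ) < i + m → X i j = 0}
  add_mem' hX hY i j h := by rw [Matrix.add_apply, hX i j h, hY i j h, add_zero]
  zero_mem' _ _ _ := rfl
  smul_mem' r X hX i j h := by rw [Matrix.smul_apply, hX i j h, smul_zero]

variable {R}

theorem upperBand_antitone : Antitone (upperBand R n) :=
  fun _ _ h _ hX i j hij => hX i j (by omega)

theorem one_mem_upperBand : (1 : Matrix (Fin n) (Fin n) R) ∈ upperBand R n 0 :=
  fun i j hij => Matrix.one_apply_ne (by rintro rfl; omega)

theorem mul_mem_upperBand {X Y : Matrix (Fin n) (Fin n) R} (hX : X ∈ upperBand R n m)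
    (hY : Y ∈ upperBand R n m') : X * Y ∈ upperBand R n (m + m') := fun i j hij => by
  rw [Matrix.mul_apply]
  refine Finset.sum_eq_zero fun l _ => ?_
  by_cases h : (l : ℕ) < i + m
  · rw [hX i l h, zero_mul]
  · rw [hY l j (by omega), mul_zero]

theorem pow_mem_upperBand {X : Matrix (Fin n) (Fin n) R} (hX : X ∈ upperBand R n m) (q : ℕ) :
    X ^ q ∈ upperBand R n (m * q) := by
  induction q with
  | zero => exact one_mem_upperBand
  | succ q ih => exact mul_mem_upperBand ih hX

theorem upperBand_eq_bot (h : n ≤ m) : upperBand R n m = ⊥ :=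
  (Submodule.eq_bot_iff _).2 fun X hX => by
    ext i j
    exact hX i j (by omega)

theorem units_inv_mem_upperBand {R : Type*} [CommRing R] (v : (Matrix (Fin n) (Fin n) R)ˣ)
    (hv : (v : Matrix (Fin n) (Fin n) R) ∈ upperBand R n 0) :
    (↑v⁻¹ : Matrix (Fin n) (Fin n) R) ∈ upperBand R n 0 := by
  have : Invertible (v : Matrix (Fin n) (Fin n) R) := v.invertible
  have htri : (v : Matrix (Fin n) (Fin n) R).BlockTriangular id := fun i j hij => hv i j hij
  rw [Matrix.coe_units_inv]
  exact fun i j hij => Matrix.blockTriangular_inv_of_blockTriangular htri hij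

/-- The upper triangular part of a matrix, the diagonal included. -/
def upperPart (X : Matrix (Fin n) (Fin n) R) : Matrix (Fin n) (Fin n) R :=
  Matrix.of fun i j => if i ≤ j then X i j else 0

theorem upperPart_mem_upperBand (X : Matrix (Fin n) (Fin n) R) : upperPart X ∈ upperBand R n 0 :=
  fun _ _ h => if_neg (not_le.2 h)

end UpperBand

section LowerPart

variable {n : ℕ}

theorem sum_pow_le_of_injOn {ι : Type*} {s : Finset ι} {g : ι → ℕ} (hg : Set.InjOn g s)
    (hpos : ∀ i ∈ s, 0 < g i) {r : ℝ} (hr : 0 ≤ r) (hr1 : r < 1) :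
    ∑ i ∈ s, r ^ g i ≤ r / (1 - r) := by
  have hinj : Set.InjOn (fun i => g i - 1) s := fun i hi j hj hij =>
    hg hi hj (by have := hpos i hi; have := hpos j hj; dsimp only at hij; omega)
  calc ∑ i ∈ s, r ^ g i = ∑ i ∈ s, r * r ^ (g i - 1) :=
        Finset.sum_congr rfl fun i hi => (mul_pow_sub_one (hpos i hi).ne' r).symm
    _ = r * ∑ k ∈ s.image fun i => g i - 1, r ^ k := by rw [Finset.sum_image hinj, Finset.mul_sum]
    _ ≤ r * (1 - r)⁻¹ := by
        rw [← tsum_geometric_of_lt_one hr hr1]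
        gcongr
        exact (summable_geometric_of_lt_one hr hr1).sum_le_tsum _ fun k _ => by positivity
    _ = r / (1 - r) := (div_eq_mul_inv _ _).symm

variable {𝕜 : Type*} [RCLike 𝕜]

theorem norm_sub_upperPart_le {X : Matrix (Fin n) (Fin n) 𝕜} {P r : ℝ} (hP : 0 ≤ P) (hr : 0 ≤ r)
    (hr1 : r < 1) (h : ∀ i j, j < i → ‖X i j‖ ≤ P * r ^ ((i : ℕ) - j)) :
    ‖X - upperPart X‖ ≤ P * (r / (1 - r)) := by
  have hb : 0 ≤ P * (r / (1 - r)) := mul_nonneg hP (div_nonneg hr (by linarith))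
  have hentry : ∀ i j, ‖(X - upperPart X) i j‖ ≤ if j < i then P * r ^ ((i : ℕ) - j) else 0 := by
    intro i j
    rcases lt_or_ge j i with hij | hij
    · simpa [upperPart, hij, not_le.2 hij] using h i j hij
    · simp [upperPart, hij, not_lt.2 hij]
  have hrow : ∀ i, ∑ j, ‖(X - upperPart X) i j‖ ≤ P * (r / (1 - r)) := fun i => by
    refine (Finset.sum_le_sum fun j _ => hentry i j).trans ?_
    rw [← Finset.sum_filter, ← Finset.mul_sum]
    refine mul_le_mul_of_nonneg_left (sum_pow_le_of_injOn ?_ ?_ hr hr1) hP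
    · intro j hj k hk hjk
      simp only [Finset.coe_filter, Finset.mem_univ, true_and, Set.mem_ofPred_eq] at hj hk hjk
      omega
    · exact fun j hj => Nat.sub_pos_of_lt (Finset.mem_filter.1 hj).2
  have hcol : ∀ j, ∑ i, ‖(X - upperPart X) i j‖ ≤ P * (r / (1 - r)) := fun j => by
    refine (Finset.sum_le_sum fun i _ => hentry i j).trans ?_
    rw [← Finset.sum_filter, ← Finset.mul_sum]
    refine mul_le_mul_of_nonneg_left (sum_pow_le_of_injOn ?_ ?_ hr hr1) hP
    · intro i hi k hk hik
      simp only [Finset.coe_filter, Finset.mem_univ, true_and, Set.mem_ofPred_eq] at hi hk hik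
      omega
    · exact fun i hi => Nat.sub_pos_of_lt (Finset.mem_filter.1 hi).2
  exact (l2_opNorm_le_sqrt_mul hb hrow hcol).trans_eq (Real.sqrt_mul_self hb)

end LowerPart

section UniformInverse

variable {n : ℕ} [NeZero n] {𝕜 : Type*} [RCLike 𝕜] {X T u : Matrix (Fin n) (Fin n) 𝕜}
  {P : ℝ} {m q : ℕ}

-- `1 + T = (1 + R) * (1 + (1 + R)⁻¹ * u * T)` for `R = T - u * T`, and the band of the nilpotent
-- second factor makes its index at most `q`.
theorem isUnitWithBound_one_add_of_mem_upperBand (hT : T ∈ upperBand 𝕜 n 0)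
    (hu : u ∈ upperBand 𝕜 n m) (hmq : n ≤ m * q) (huT : ‖T - u * T‖ ≤ 1 / 2) (hP : ‖u * T‖ ≤ P) :
    IsUnitWithBound ((∑ i ∈ Finset.range q, (2 * P) ^ i) * 2) (1 + T) := by
  obtain ⟨v, hv, hvnorm⟩ := IsUnitWithBound.one_add_of_norm_le_half huT
  have huTmem : u * T ∈ upperBand 𝕜 n m := mul_mem_upperBand hu hT
  have hvinv := units_inv_mem_upperBand v <| hv ▸
    add_mem one_mem_upperBand (sub_mem hT (upperBand_antitone (Nat.zero_le m) huTmem))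
  have hnil : (v⁻¹.val * (u * T)) ^ q = 0 := by
    have hmem := pow_mem_upperBand (mul_mem_upperBand hvinv huTmem) q
    rwa [zero_add, upperBand_eq_bot hmq, Submodule.mem_bot] at hmem
  have hfactor : v.val * (1 + v⁻¹.val * (u * T)) = 1 + T := by
    rw [mul_add, mul_one, Units.mul_inv_cancel_left, hv]
    abel
  rw [← hfactor]
  exact IsUnitWithBound.mul ⟨v, rfl, hvnorm⟩
    (IsUnitWithBound.one_add_of_pow_eq_zero hnil (norm_mul_le_of_le hvnorm hP))

theorem isUnitWithBound_one_add_of_norm_sub_upperPart_le (hu : u ∈ upperBand 𝕜 n m)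
    (hu1 : ‖u‖ ≤ 1) (hmq : n ≤ m * q) (huX : ‖u * X - X‖ ≤ 1 / 4) (hP : ‖X‖ ≤ P)
    (hS : ‖X - upperPart X‖ ≤ 1 / 8)
    (hKS : (∑ i ∈ Finset.range q, (2 * (P + 1)) ^ i) * 2 * ‖X - upperPart X‖ ≤ 1 / 2) :
    IsUnitWithBound (2 * ((∑ i ∈ Finset.range q, (2 * (P + 1)) ^ i) * 2)) (1 + X) := by
  have huS : ‖u * (X - upperPart X)‖ ≤ 1 * (1 / 8) := norm_mul_le_of_le hu1 hS
  have huT : ‖upperPart X - u * upperPart X‖ ≤ 1 / 2 := by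
    calc ‖upperPart X - u * upperPart X‖
        = ‖u * (X - upperPart X) - (X - upperPart X) - (u * X - X)‖ := by noncomm_ring
      _ ≤ 1 * (1 / 8) + 1 / 8 + 1 / 4 := norm_sub_le_of_le (norm_sub_le_of_le huS hS) huX
      _ = 1 / 2 := by norm_num
  have hPT : ‖u * upperPart X‖ ≤ P + 1 := by
    calc ‖u * upperPart X‖ ≤ 1 * ‖X - (X - upperPart X)‖ := by
          rw [sub_sub_cancel]; exact norm_mul_le_of_le hu1 le_rfl
      _ ≤ 1 * (P + 1 / 8) := by gcongr; exact norm_sub_le_of_le hP hS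
      _ ≤ P + 1 := by linarith
  have hinv := (isUnitWithBound_one_add_of_mem_upperBand (upperPart_mem_upperBand X) hu hmq huT
    hPT).add_of_mul_norm_le_half hKS
  rwa [add_assoc, add_sub_cancel] at hinv

end UniformInverse

variable {c : ℕ+ → ℝ}

section Matrices

variable {n k : ℕ+}

section Shift

theorem shift_pow_apply (m : ℕ) (i j : Fin n) :
    (shift n ^ m) i j = if (i : ℕ) + m = j then 1 else 0 := by
  induction m generalizing i with
  | zero => simp [Matrix.one_apply, Fin.ext_iff]
  | succ m ih =>
    simp only [pow_succ', Matrix.mul_apply, ih]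
    simp only [shift, Matrix.of_apply, ← ite_and, mul_ite, mul_one, mul_zero]
    by_cases hi : (i : ℕ) + 1 < n
    · rw [Finset.sum_eq_single ⟨i + 1, hi⟩ (fun l _ hl => if_neg fun h => hl (Fin.ext h.2.symm))
        (fun h => absurd (Finset.mem_univ _) h)]
      exact if_congr (by dsimp only; omega) rfl rfl
    · rw [Finset.sum_eq_zero fun l _ => if_neg (by omega), if_neg (by omega)]

theorem norm_shift_le : ‖shift n‖ ≤ 1 := by
  have hnorm (i j : Fin n) : ‖shift n i j‖ = if (i : ℕ) + 1 = j then 1 else 0 := by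
    rw [shift, Matrix.of_apply, apply_ite norm, norm_one, norm_zero]
  have hrow (i : Fin n) : ∑ j, ‖shift n i j‖ ≤ 1 := by
    simp only [hnorm, Finset.sum_boole, Nat.cast_le_one, Finset.card_le_one, Finset.mem_filter]
    omega
  have hcol (j : Fin n) : ∑ i, ‖shift n i j‖ ≤ 1 := by
    simp only [hnorm, Finset.sum_boole, Nat.cast_le_one, Finset.card_le_one, Finset.mem_filter]
    omega
  simpa using l2_opNorm_le_sqrt_mul zero_le_one hrow hcol

theorem powAvg_shift_mem_upperBand {m : ℕ} {F : Finset ℕ} (h : ∀ i ∈ F, m ≤ i) :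
    powAvg (shift n) F ∈ upperBand ℂ n m :=
  Submodule.smul_mem _ _ <| sum_mem fun l hl i j hij => by
    rw [shift_pow_apply, if_neg]
    have := h l hl
    omega

end Shift

section Exponents

theorem mem_E {i : ℕ} : i ∈ E n k ↔ (n : ℕ) ≤ i * k ∧ i * k ≤ 2 * n := by
  have hk : (0 : ℚ) < (k : ℕ) := by exact_mod_cast k.pos
  rw [E, Finset.mem_Icc, Nat.ceil_le, Nat.le_floor_iff (by positivity), div_le_iff₀ hk,
    le_div_iff₀ hk]
  norm_cast

theorem pos_of_mem_E {i : ℕ} (hi : i ∈ E n k) : 0 < i :=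
  Nat.pos_of_mul_pos_right (n.pos.trans_le (mem_E.1 hi).1)

theorem ceil_le_floor_of_le (hk : k ≤ n) :
    ⌈((n : ℕ) : ℚ) / (k : ℕ)⌉₊ ≤ ⌊2 * ((n : ℕ) : ℚ) / (k : ℕ)⌋₊ := by
  have hone : (1 : ℚ) ≤ ((n : ℕ) : ℚ) / (k : ℕ) :=
    (one_le_div (by exact_mod_cast k.pos)).2 (by exact_mod_cast hk)
  have hceil := Nat.ceil_lt_add_one (zero_le_one.trans hone)
  refine Nat.le_floor ?_
  rw [mul_div_assoc]
  linarith

theorem E_nonempty (hk : k ≤ n) : (E n k).Nonempty :=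
  Finset.nonempty_Icc.2 (ceil_le_floor_of_le hk)

theorem le_two_mul_card_E (hk : k ≤ n) : (n : ℝ) ≤ 2 * k * (E n k).card := by
  have hk0 : (0 : ℚ) < (k : ℕ) := by exact_mod_cast k.pos
  have hone : (1 : ℚ) ≤ (E n k).card := by exact_mod_cast (E_nonempty hk).card_pos
  have hlen : ((n : ℕ) : ℚ) / (k : ℕ) - 1 ≤ (E n k).card := by
    have hceil := Nat.ceil_lt_add_one (a := ((n : ℕ) : ℚ) / (k : ℕ)) (by positivity)
    have hfloor := Nat.lt_floor_add_one (2 * ((n : ℕ) : ℚ) / (k : ℕ))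
    rw [E, Nat.card_Icc, Nat.cast_sub ((ceil_le_floor_of_le hk).trans (Nat.le_succ _))]
    push_cast
    rw [mul_div_assoc] at hfloor ⊢
    linarith
  have hdiv : ((n : ℕ) : ℚ) ≤ 2 * (E n k).card * (k : ℕ) := (div_le_iff₀ hk0).1 (by linarith)
  rw [mul_right_comm]
  exact_mod_cast hdiv

end Exponents

section DiagonalConjugation

theorem det_d_ne_zero (hc : c n ≠ 0) : (d c n).det ≠ 0 := by
  rw [d, Matrix.det_diagonal]
  exact Finset.prod_ne_zero_iff.2 fun i _ => pow_ne_zero _ (Complex.ofReal_ne_zero.2 hc)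

/-- The automorphism `x ↦ dₙ x dₙ⁻¹` of the algebra of matrices. -/
noncomputable def dConj (hc : c n ≠ 0) : Mat n ≃ₐ[ℂ] Mat n :=
  MulSemiringAction.toAlgEquiv ℂ (Mat n)
    (ConjAct.toConjAct (Matrix.GeneralLinearGroup.mkOfDetNeZero (d c n) (det_d_ne_zero hc)))

theorem dConj_apply (hc : c n ≠ 0) (X : Mat n) : dConj hc X = d c n * X * (d c n)⁻¹ := by
  rw [dConj, MulSemiringAction.toAlgEquiv_apply, ConjAct.units_smul_def, Matrix.coe_units_inv]
  rfl

theorem dConj_mul_d (hc : c n ≠ 0) (X : Mat n) : dConj hc X * d c n = d c n * X := by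
  rw [dConj_apply, Matrix.nonsing_inv_mul_cancel_right _ _ (det_d_ne_zero hc).isUnit]

theorem dConj_apply_apply (hc : c n ≠ 0) (X : Mat n) (i j : Fin n) :
    dConj hc X i j * (c n : ℂ) ^ ((j : ℕ) + 1) = (c n : ℂ) ^ ((i : ℕ) + 1) * X i j := by
  have h := congr_fun (congr_fun (dConj_mul_d hc X) i) j
  rwa [d, Matrix.mul_diagonal, Matrix.diagonal_mul] at h

theorem dConj_shift (hc : c n ≠ 0) : dConj hc (shift n) = (c n : ℂ)⁻¹ • shift n := by
  have hc' : (c n : ℂ) ≠ 0 := Complex.ofReal_ne_zero.2 hc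
  ext i j
  refine mul_right_cancel₀ (pow_ne_zero ((j : ℕ) + 1) hc') ?_
  rw [dConj_apply_apply, Matrix.smul_apply, smul_eq_mul, shift, Matrix.of_apply]
  split_ifs with hij
  · rw [← hij, pow_succ _ ((i : ℕ) + 1)]
    field_simp
  · simp only [mul_zero, zero_mul]

theorem norm_apply_le_norm_dConj_mul_pow (hc : c n ≠ 0) (X : Mat n) {i j : Fin n} (hij : j < i) :
    ‖X i j‖ ≤ ‖dConj hc X‖ * |c n|⁻¹ ^ ((i : ℕ) - j) := by
  have hpos : 0 < |c n| := abs_pos.2 hc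
  have hexp : (i : ℕ) + 1 = j + 1 + (i - j) := by omega
  have h := congr_arg norm (dConj_apply_apply hc X i j)
  simp only [norm_mul, norm_pow, Complex.norm_real, Real.norm_eq_abs] at h
  rw [hexp, pow_add _ ((j : ℕ) + 1), mul_assoc, mul_comm,
    mul_right_inj' (pow_pos hpos _).ne'] at h
  rw [inv_pow, ← div_eq_mul_inv, le_div_iff₀' (pow_pos hpos _), ← h]
  exact norm_entry_le _ i j

/-- The embedding `x ↦ (x, dₙ x dₙ⁻¹)`. -/
noncomputable def dPair (hc : c n ≠ 0) : Mat n →ₐ[ℂ] Mat n × Mat n :=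
  (AlgHom.id ℂ (Mat n)).prod (dConj hc)

theorem mem_N_iff (hc : ∀ n, c n ≠ 0) {a : M} : a ∈ N c ↔ ∀ n, a n = dPair (hc n) (a n).1 :=
  forall_congr' fun n => by
    rw [← dConj_apply (hc n)]
    exact ⟨fun h => Prod.ext rfl h, fun h => congr_arg Prod.snd h⟩

end DiagonalConjugation

section Averages

theorem u_of_le (hk : k ≤ n) : u n k = powAvg (shift n) (E n k) := if_pos hk

theorem U_eq_dPair (hc : c n ≠ 0) : U c k n = dPair hc (u n k) :=
  Prod.ext rfl (dConj_apply hc _).symm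

theorem U_of_le (hc : c n ≠ 0) (hk : k ≤ n) :
    U c k n = powAvg (dPair hc (shift n)) (E n k) := by
  rw [U_eq_dPair hc, u_of_le hk, map_powAvg]

theorem U_of_lt (hc : c n ≠ 0) (hk : n < k) : U c k n = 1 := by
  rw [U_eq_dPair hc, u, if_neg hk.not_ge, map_one]

theorem commute_U (hc : c n ≠ 0) (k m : ℕ+) : Commute (U c k n) (U c m n) := by
  rcases le_or_gt k n with hk | hk
  · rcases le_or_gt m n with hm | hm
    · rw [U_of_le hc hk, U_of_le hc hm]
      exact commute_powAvg _ _ _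
    · rw [U_of_lt hc hm]
      exact Commute.one_right _
  · rw [U_of_lt hc hk]
    exact Commute.one_left _

theorem norm_dConj_shift_le (hc : c n ≠ 0) : ‖dConj hc (shift n)‖ ≤ |c n|⁻¹ := by
  rw [dConj_shift, norm_smul, norm_inv, Complex.norm_real, Real.norm_eq_abs]
  exact mul_le_of_le_one_right (by positivity) norm_shift_le

theorem ne_zero_of_one_le_abs (hc1 : 1 ≤ |c n|) : c n ≠ 0 :=
  abs_pos.1 (zero_lt_one.trans_le hc1)

theorem norm_dPair_shift_le (hc1 : 1 ≤ |c n|) :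
    ‖dPair (ne_zero_of_one_le_abs hc1) (shift n)‖ ≤ 1 :=
  norm_prod_le_iff.2 ⟨norm_shift_le, (norm_dConj_shift_le _).trans (inv_le_one_of_one_le₀ hc1)⟩

theorem norm_U_le_one (hc1 : 1 ≤ |c n|) (k : ℕ+) : ‖U c k n‖ ≤ 1 := by
  rcases le_or_gt k n with hk | hk
  · rw [U_of_le (ne_zero_of_one_le_abs hc1) hk]
    exact norm_powAvg_le (E_nonempty hk) fun i _ => norm_pow_le_one (norm_dPair_shift_le hc1) i
  · rw [U_of_lt (ne_zero_of_one_le_abs hc1) hk, norm_one]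

theorem norm_U_snd_le (hc1 : 1 ≤ |c n|) (hk : k ≤ n) : ‖(U c k n).2‖ ≤ |c n|⁻¹ := by
  have hc := ne_zero_of_one_le_abs hc1
  have hsnd : (U c k n).2 = powAvg (dConj hc (shift n)) (E n k) := by
    rw [← AlgHom.coe_coe, ← map_powAvg, ← u_of_le hk]
    exact (dConj_apply hc _).symm
  have hle := norm_dConj_shift_le hc
  rw [hsnd]
  refine norm_powAvg_le (E_nonempty hk) fun i hi => ?_
  calc ‖dConj hc (shift n) ^ i‖ ≤ ‖dConj hc (shift n)‖ ^ i := norm_pow_le _ i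
    _ ≤ ‖dConj hc (shift n)‖ := pow_le_of_le_one (norm_nonneg _)
        (hle.trans (inv_le_one_of_one_le₀ hc1)) (pos_of_mem_E hi).ne'
    _ ≤ |c n|⁻¹ := hle

theorem norm_U_mul_U_sub_le (hc1 : 1 ≤ |c n|) {m : ℕ+} (hk : k ≤ n) (hm : m ≤ n) :
    ‖U c m n * U c k n - U c k n‖ ≤ 8 * k / m := by
  have hm0 : (0 : ℝ) < m := by exact_mod_cast m.pos
  have hcard : (0 : ℝ) < (E n k).card := by exact_mod_cast (E_nonempty hk).card_pos
  have hE (i : ℕ) (hi : i ∈ E n m) : (i : ℝ) ≤ 2 * n / m := by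
    rw [le_div_iff₀ hm0]
    exact_mod_cast (mem_E.1 hi).2
  have hc := ne_zero_of_one_le_abs hc1
  calc ‖U c m n * U c k n - U c k n‖ ≤ 2 * n / m * (2 / (E n k).card) := by
        rw [U_of_le hc hk, U_of_le hc hm]
        exact norm_powAvg_mul_powAvg_Icc_sub_le (norm_dPair_shift_le hc1) (E_nonempty hm) hE
          (ceil_le_floor_of_le hk)
    _ ≤ 8 * k / m := by
        rw [div_mul_div_comm, div_le_div_iff₀ (by positivity) hm0]
        nlinarith [le_two_mul_card_E hk]

end Averages

end Matrices

section ApproximateUnit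

variable (hlim : Tendsto (fun n => |c n|) atTop atTop)

/-- The sequence `uₖ = (uₙₖ)ₙ`, as an element of `M`. -/
noncomputable def approxUnit (k : ℕ+) : M :=
  ⟨U c k, memℓp_infty <| bddAbove_range_of_eventually_le <|
    (hlim.eventually_ge_atTop 1).mono fun _ hn => norm_U_le_one hn k⟩

theorem approxUnit_apply (k n : ℕ+) : approxUnit hlim k n = U c k n := rfl

theorem eventually_norm_approxUnit_le (hc : ∀ n, c n ≠ 0) :
    ∀ᶠ k in atTop, ‖approxUnit hlim k‖ ≤ 1 := by
  filter_upwards [eventually_forall_ge_atTop.2 (hlim.eventually_ge_atTop 1)] with k hk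
  refine lp.norm_le_of_forall_le zero_le_one fun n => ?_
  rw [approxUnit_apply]
  rcases le_or_gt k n with hn | hn
  · exact norm_U_le_one (hk n hn) k
  · rw [U_of_lt (hc n) hn, norm_one]

theorem bddAbove_range_norm_approxUnit (hc : ∀ n, c n ≠ 0) :
    BddAbove (Set.range fun k => ‖approxUnit hlim k‖) :=
  bddAbove_range_of_eventually_le (eventually_norm_approxUnit_le hlim hc)

theorem defect_eq (a : M) (k : ℕ+) : defect c a k =
    edist (a * approxUnit hlim k) a + edist (approxUnit hlim k * a) a := by
  rw [edist_eq_enorm_sub, edist_eq_enorm_sub, ← p_coe, ← p_coe]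
  rfl

theorem mem_A_iff {a : M} : a ∈ A c ↔ a ∈ N c ∧
    Tendsto (fun k => approxUnit hlim k * a) atTop (𝓝 a) ∧
    Tendsto (fun k => a * approxUnit hlim k) atTop (𝓝 a) := by
  refine and_congr_right fun _ => ?_
  simp only [tendsto_iff_edist_tendsto_0, funext (defect_eq hlim a)]
  refine ⟨fun h => ⟨?_, ?_⟩, fun h => add_zero (0 : ℝ≥0∞) ▸ h.2.add h.1⟩
  · exact tendsto_of_tendsto_of_tendsto_of_le_of_le tendsto_const_nhds h (fun _ => zero_le)
      fun _ => le_add_self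
  · exact tendsto_of_tendsto_of_tendsto_of_le_of_le tendsto_const_nhds h (fun _ => zero_le)
      fun _ => le_self_add

theorem continuous_apply_M (n : ℕ+) : Continuous fun a : M => a n :=
  (continuous_apply n).comp lp.uniformContinuous_coe.continuous

theorem isClosed_N : IsClosed (N c : Set M) := by
  have hN : (N c : Set M) = {a | ∀ n, (a n).2 = d c n * (a n).1 * (d c n)⁻¹} := rfl
  rw [hN, Set.ofPred_forall]
  exact isClosed_iInter fun n => isClosed_eq (continuous_apply_M n).snd
    ((continuous_const.mul (continuous_apply_M n).fst).mul continuous_const)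

include hlim in
theorem isClosed_A (hc : ∀ n, c n ≠ 0) : IsClosed (A c : Set M) := by
  have hN : (A c : Set M) = (N c : Set M) ∩ _ := Set.ext fun _ => mem_A_iff hlim
  rw [hN]
  exact isClosed_N.inter (isClosed_setOf_tendsto_mul (bddAbove_range_norm_approxUnit hlim hc))

include hlim in
theorem mul_mem_A {a z z' : M} (ha : a ∈ A c) (hN : z * a ∈ N c) (h : z * a = a * z') :
    z * a ∈ A c := by
  obtain ⟨-, hleft, hright⟩ := (mem_A_iff hlim).1 ha
  refine (mem_A_iff hlim).2 ⟨hN, ?_, ?_⟩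
  · simpa only [h, mul_assoc] using hleft.mul_const z'
  · simpa only [mul_assoc] using hright.const_mul z

theorem approxUnit_mem_N (k : ℕ+) : approxUnit hlim k ∈ N c := fun _ => rfl

theorem commute_approxUnit (hc : ∀ n, c n ≠ 0) (k m : ℕ+) :
    Commute (approxUnit hlim k) (approxUnit hlim m) :=
  lp.ext <| funext fun n => commute_U (hc n) k m

theorem norm_approxUnit_mul_sub_le (hc : ∀ n, c n ≠ 0) {k m : ℕ+} (hkm : k ≤ m)
    (hm : ∀ n ≥ m, 1 ≤ |c n|) :
    ‖approxUnit hlim m * approxUnit hlim k - approxUnit hlim k‖ ≤ 8 * k / m := by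
  refine lp.norm_le_of_forall_le (by positivity) fun n => ?_
  change ‖U c m n * U c k n - U c k n‖ ≤ _
  rcases le_or_gt m n with hn | hn
  · exact norm_U_mul_U_sub_le (hm n hn) (hkm.trans hn) hn
  · rw [U_of_lt (hc n) hn, one_mul, sub_self, norm_zero]
    positivity

theorem approxUnit_mem_A (hc : ∀ n, c n ≠ 0) (k : ℕ+) : approxUnit hlim k ∈ A c := by
  have hleft : Tendsto (fun m => approxUnit hlim m * approxUnit hlim k) atTop
      (𝓝 (approxUnit hlim k)) := by
    have hzero : Tendsto (fun m : ℕ+ => 8 * (k : ℝ) / m) atTop (𝓝 0) :=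
      (tendsto_const_div_atTop_nhds_zero_nat _).comp tendsto_PNat_val_atTop_atTop
    refine tendsto_iff_norm_sub_tendsto_zero.2 <|
      squeeze_zero' (Eventually.of_forall fun _ => norm_nonneg _) ?_ hzero
    filter_upwards [eventually_ge_atTop k,
      eventually_forall_ge_atTop.2 (hlim.eventually_ge_atTop 1)] with m hkm hm
    exact norm_approxUnit_mul_sub_le hlim hc hkm hm
  exact (mem_A_iff hlim).2 ⟨approxUnit_mem_N hlim k, hleft,
    hleft.congr fun m => commute_approxUnit hlim hc m k⟩

include hlim in
theorem isApproximatelyUnital (hc : ∀ n, c n ≠ 0) : IsApproximatelyUnital (A c) :=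
  isApproximatelyUnital_of_tendsto (l := atTop)
    (v := fun k => (⟨approxUnit hlim k, approxUnit_mem_A hlim hc k⟩ : A c))
    (eventually_norm_approxUnit_le hlim hc)
    (fun a => tendsto_subtype_rng.2 ((mem_A_iff hlim).1 a.2).2.1)
    (fun a => tendsto_subtype_rng.2 ((mem_A_iff hlim).1 a.2).2.2)

theorem norm_apply_snd_le {k n : ℕ+} (a : M) (hn : 1 ≤ |c n|) (hk : k ≤ n) :
    ‖(a n).2‖ ≤ ‖a * approxUnit hlim k - a‖ + ‖a‖ * |c n|⁻¹ := by
  have hsub : ‖(a n).2 * (U c k n).2 - (a n).2‖ ≤ ‖a * approxUnit hlim k - a‖ :=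
    (norm_snd_le _).trans (lp.norm_apply_le_norm ENNReal.top_ne_zero (a * approxUnit hlim k - a) n)
  have hmul : ‖(a n).2 * (U c k n).2‖ ≤ ‖a‖ * |c n|⁻¹ :=
    norm_mul_le_of_le ((norm_snd_le _).trans (lp.norm_apply_le_norm ENNReal.top_ne_zero a n))
      (norm_U_snd_le hn hk)
  rw [norm_sub_rev] at hsub
  exact (norm_le_norm_sub_add _ ((a n).2 * (U c k n).2)).trans (add_le_add hsub hmul)

include hlim in
theorem tendsto_norm_snd {a : M} (ha : a ∈ A c) :
    Tendsto (fun n => ‖(a n).2‖) atTop (𝓝 0) := by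
  have hright := tendsto_iff_norm_sub_tendsto_zero.1 ((mem_A_iff hlim).1 ha).2.2
  have hinv : Tendsto (fun n => ‖a‖ * |c n|⁻¹) atTop (𝓝 0) := by
    simpa only [mul_zero, Pi.inv_apply] using hlim.inv_tendsto_atTop.const_mul ‖a‖
  refine tendsto_order.2
    ⟨fun _ hr => Eventually.of_forall fun _ => hr.trans_le (norm_nonneg _), fun ε hε => ?_⟩
  obtain ⟨k, hk⟩ := (hright.eventually_lt_const (half_pos hε)).exists
  filter_upwards [eventually_ge_atTop k, hlim.eventually_ge_atTop 1,
    hinv.eventually_lt_const (half_pos hε)] with n hkn hn hinvn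
  linarith [norm_apply_snd_le hlim a hn hkn]

end ApproximateUnit

section Quasiregularity

theorem norm_fst_apply_le_mul_pow {n : ℕ+} (hc : c n ≠ 0) {a : M} (ha : a ∈ N c) {i j : Fin n}
    (hij : j < i) : ‖(a n).1 i j‖ ≤ ‖a‖ * |c n|⁻¹ ^ ((i : ℕ) - j) := by
  refine (norm_apply_le_norm_dConj_mul_pow hc _ hij).trans ?_
  rw [dConj_apply, ← ha n]
  gcongr
  exact (norm_snd_le _).trans (lp.norm_apply_le_norm ENNReal.top_ne_zero a n)

theorem tendsto_norm_fst_sub_upperPart (hlim : Tendsto (fun n => |c n|) atTop atTop)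
    (hc : ∀ n, c n ≠ 0) {a : M} (ha : a ∈ N c) :
    Tendsto (fun n => ‖(a n).1 - upperPart (a n).1‖) atTop (𝓝 0) := by
  have hinv : Tendsto (fun n => |c n|⁻¹) atTop (𝓝 0) := hlim.inv_tendsto_atTop
  have hbound : Tendsto (fun n => ‖a‖ * (|c n|⁻¹ / (1 - |c n|⁻¹))) atTop (𝓝 0) := by
    simpa using (hinv.div (hinv.const_sub 1) (by norm_num)).const_mul ‖a‖
  refine squeeze_zero' (Eventually.of_forall fun _ => norm_nonneg _) ?_ hbound
  filter_upwards [hinv.eventually_lt_const one_pos] with n hn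
  exact norm_sub_upperPart_le (norm_nonneg a) (by positivity) hn
    fun i j hij => norm_fst_apply_le_mul_pow (hc n) ha hij

theorem exists_isUnitWithBound_one_add_fst (hlim : Tendsto (fun n => |c n|) atTop atTop)
    (hc : ∀ n, c n ≠ 0) {a : M} (ha : a ∈ A c) :
    ∃ K, ∀ᶠ n in atTop, IsUnitWithBound K (1 + (a n).1) := by
  have hleft := tendsto_iff_norm_sub_tendsto_zero.1 ((mem_A_iff hlim).1 ha).2.1
  have hS := tendsto_norm_fst_sub_upperPart hlim hc ha.1
  obtain ⟨k, hk⟩ := (hleft.eventually_le_const (by norm_num : (0 : ℝ) < 1 / 4)).exists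
  set C := (∑ i ∈ Finset.range (k : ℕ), (2 * (‖a‖ + 1)) ^ i) * 2
  have hCS : Tendsto (fun n => C * ‖(a n).1 - upperPart (a n).1‖) atTop (𝓝 0) := by
    simpa only [mul_zero] using hS.const_mul C
  refine ⟨2 * C, ?_⟩
  filter_upwards [eventually_ge_atTop k, hlim.eventually_ge_atTop 1,
    hS.eventually_le_const (by norm_num : (0 : ℝ) < 1 / 8),
    hCS.eventually_le_const (by norm_num : (0 : ℝ) < 1 / 2)] with n hkn hn hSn hCSn
  have hE : ⌈((n : ℕ) : ℚ) / (k : ℕ)⌉₊ ∈ E n k := Finset.left_mem_Icc.2 (ceil_le_floor_of_le hkn)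
  have hnear : ‖(U c k n).1 * (a n).1 - (a n).1‖ ≤ 1 / 4 := (norm_fst_le _).trans <|
    (lp.norm_apply_le_norm ENNReal.top_ne_zero (approxUnit hlim k * a - a) n).trans hk
  refine isUnitWithBound_one_add_of_norm_sub_upperPart_le (u := (U c k n).1) ?_
    ((norm_fst_le _).trans (norm_U_le_one hn k)) (mem_E.1 hE).1 hnear
    ((norm_fst_le _).trans (lp.norm_apply_le_norm ENNReal.top_ne_zero a n)) hSn hCSn
  change u n k ∈ _
  rw [u_of_le hkn]
  exact powAvg_shift_mem_upperBand fun i hi => (Finset.mem_Icc.1 hi).1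

theorem exists_isUnitWithBound_one_add (hlim : Tendsto (fun n => |c n|) atTop atTop)
    (hc : ∀ n, c n ≠ 0) {a : M} (ha : a ∈ A c) :
    ∃ K, ∀ᶠ n in atTop, IsUnitWithBound K (1 + a n) := by
  obtain ⟨K, hK⟩ := exists_isUnitWithBound_one_add_fst hlim hc ha
  refine ⟨max K 2, ?_⟩
  filter_upwards [hK, (tendsto_norm_snd hlim ha).eventually_le_const
    (by norm_num : (0 : ℝ) < 1 / 2)] with n hfst hsnd
  exact (hfst.mono (le_max_left K 2)).prodMk
    ((IsUnitWithBound.one_add_of_norm_le_half hsnd).mono (le_max_right K 2))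

theorem isUnit_one_add_apply_iff {n : ℕ+} (hc : c n ≠ 0) {a : M} (ha : a ∈ N c) :
    IsUnit (1 + a n) ↔ IsUnit (1 + (a n).2) := by
  have hconj : dConj hc (1 + (a n).1) = 1 + (a n).2 := by
    rw [map_add, map_one, dConj_apply, ← ha n]
  rw [Prod.isUnit_iff, Prod.fst_add, Prod.snd_add, Prod.fst_one, Prod.snd_one, ← hconj,
    MulEquiv.isUnit_map (dConj hc), and_self]

theorem units_inv_mem_N (hc : ∀ n, c n ≠ 0) {v : Mˣ} (hv : v.val ∈ N c) : v⁻¹.val ∈ N c := by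
  rw [mem_N_iff hc] at hv ⊢
  intro n
  have hmul : (v⁻¹.val * v.val) n = 1 := by rw [v.inv_mul]; rfl
  have hmul' : (v.val * v⁻¹.val) n = 1 := by rw [v.mul_inv]; rfl
  refine left_inv_eq_right_inv hmul ?_
  rw [hv n, ← map_mul, ← Prod.fst_mul]
  exact (congr_arg _ (congr_arg Prod.fst hmul')).trans (map_one _)

theorem one_mem_N (hc : ∀ n, c n ≠ 0) : (1 : M) ∈ N c :=
  (mem_N_iff hc).2 fun n => (map_one (dPair (hc n))).symm

theorem isQuasiregular_of_isUnit (hlim : Tendsto (fun n => |c n|) atTop atTop)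
    (hc : ∀ n, c n ≠ 0) (a : A c)
    (h : ∀ n, IsUnit (1 + ((a : M) n).2)) : IsQuasiregular a := by
  obtain ⟨K, hK⟩ := exists_isUnitWithBound_one_add hlim hc a.2
  obtain ⟨v, hv⟩ : IsUnit (1 + (a : M)) :=
    isUnit_lp_infty (fun n => (isUnit_one_add_apply_iff (hc n) a.2.1).2 (h n))
      (cofinite_le_atTop hK)
  have hvN : v⁻¹.val ∈ N c := units_inv_mem_N hc (hv ▸ add_mem (one_mem_N hc) a.2.1)
  have hcomm : Commute (a : M) v⁻¹.val := by
    refine Commute.units_inv_right ?_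
    rw [hv]
    exact (Commute.one_right _).add_right (Commute.refl _)
  exact isQuasiregular_of_units_inv_mul_mem hv
    (mul_mem_A hlim a.2 (mul_mem hvN a.2.1) hcomm.symm)

end Quasiregularity

section Spectrum

theorem quasispectrum_subset (hlim : Tendsto (fun n => |c n|) atTop atTop) (hc : ∀ n, c n ≠ 0)
    (a : A c) : quasispectrum ℂ a ⊆ insert 0 (⋃ n, spectrum ℂ ((a : M) n).2) := by
  intro z hz
  by_contra! hmem
  simp only [Set.mem_insert_iff, Set.mem_iUnion, not_or, not_exists] at hmem
  have hunit : IsUnit z := isUnit_iff_ne_zero.2 hmem.1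
  refine hz hunit (isQuasiregular_of_isUnit hlim hc _ fun n => ?_)
  have hn := spectrum.notMem_iff.1 (hmem.2 n)
  rw [Algebra.algebraMap_eq_smul_one, ← hunit.unit_spec, ← Units.smul_def,
    IsUnit.smul_sub_iff_sub_inv_smul, sub_eq_add_neg] at hn
  exact hn

theorem tendsto_coe_quasispectrum (hlim : Tendsto (fun n => |c n|) atTop atTop)
    (hc : ∀ n, c n ≠ 0) (a : A c) :
    Tendsto ((↑) : quasispectrum ℂ a → ℂ) cofinite (𝓝 0) := by
  refine Metric.tendsto_nhds.2 fun ε hε => ?_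
  have hfin : {n | ¬ ‖((a : M) n).2‖ < ε}.Finite :=
    cofinite_le_atTop ((tendsto_norm_snd hlim a.2).eventually_lt_const hε)
  refine ((hfin.biUnion fun n _ => Matrix.finite_spectrum ((a : M) n).2).preimage
    Subtype.val_injective.injOn).subset fun z hz => ?_
  rw [Set.mem_compl_iff, Set.mem_ofPred_eq, dist_zero_right, not_lt] at hz
  rcases quasispectrum_subset hlim hc a z.2 with hzero | hmem
  · rw [hzero, norm_zero] at hz
    exact absurd hε hz.not_gt
  · obtain ⟨n, hn⟩ := Set.mem_iUnion.1 hmem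
    exact Set.mem_biUnion (not_lt.2 (hz.trans (spectrum.norm_le_norm_of_mem hn))) hn

end Spectrum

section LowerBound

variable {n k : ℕ+}

theorem sum_entries_shift_pow (m : ℕ) :
    ∑ i, ∑ j, (shift n ^ m) i j = ((n - m : ℕ) : ℂ) := by
  have hrow (i : Fin n) : ∑ j, (shift n ^ m) i j = if (i : ℕ) + m < n then 1 else 0 := by
    simp_rw [shift_pow_apply]
    split_ifs with hi
    · rw [Finset.sum_eq_single_of_mem ⟨i + m, hi⟩ (Finset.mem_univ _) fun j _ hj =>
        if_neg fun h => hj (Fin.ext h.symm), if_pos rfl]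
    · exact Finset.sum_eq_zero fun j _ => if_neg (by omega)
  have hfilter : {i ∈ Finset.range n | i + m < n} = Finset.range (n - m) := by
    ext i
    rw [Finset.mem_filter, Finset.mem_range, Finset.mem_range]
    omega
  simp_rw [hrow]
  rw [Fin.sum_univ_eq_sum_range (fun i => if i + m < n then (1 : ℂ) else 0) n, Finset.sum_boole,
    hfilter, Finset.card_range]

/-- The sum of the entries of a matrix. It detects the size of the powers of the shift. -/
noncomputable def entrySum (n : ℕ+) : Mat n →ₗ[ℂ] ℂ where
  toFun X := ∑ i, ∑ j, X i j
  map_add' X Y := by simp only [Matrix.add_apply, Finset.sum_add_distrib]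
  map_smul' r X := by
    simp only [Matrix.smul_apply, Finset.smul_sum, RingHom.id_apply]

theorem half_le_norm_u_mul_u (h8 : 8 ≤ k) (hk : k ≤ n) : 1 / 2 ≤ ‖u n k * u n k‖ := by
  have hpow : ∀ i ∈ E n k, ∀ j ∈ E n k,
      (n / 2 : ℝ) ≤ (entrySum n (shift n ^ i * shift n ^ j)).re := fun i hi j hj => by
    have h8' : 8 ≤ (k : ℕ) := h8
    have hi' : i * 8 ≤ 2 * n := (Nat.mul_le_mul_left i h8').trans (mem_E.1 hi).2
    have hj' : j * 8 ≤ 2 * n := (Nat.mul_le_mul_left j h8').trans (mem_E.1 hj).2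
    have hle : (n : ℝ) ≤ 2 * (n - (i + j) : ℕ) := by
      exact_mod_cast (by omega : (n : ℕ) ≤ 2 * (n - (i + j)))
    have hsum : entrySum n (shift n ^ i * shift n ^ j) = ((n - (i + j) : ℕ) : ℂ) := by
      rw [← pow_add]
      exact sum_entries_shift_pow (i + j)
    rw [hsum, Complex.natCast_re]
    linarith
  have hre : (n / 2 : ℝ) ≤ (entrySum n (u n k * u n k)).re := by
    rw [u_of_le hk]
    refine le_re_map_powAvg (entrySum n ∘ₗ LinearMap.mulRight ℂ _) (E_nonempty hk) fun i hi => ?_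
    exact le_re_map_powAvg (entrySum n ∘ₗ LinearMap.mulLeft ℂ (shift n ^ i)) (E_nonempty hk)
      (hpow i hi)
  have hnorm : ‖entrySum n (u n k * u n k)‖ ≤ n * ‖u n k * u n k‖ := by
    have := norm_sum_entries_le (u n k * u n k)
    rwa [Fintype.card_fin] at this
  have hn : (0 : ℝ) < n := Nat.cast_pos.2 n.pos
  refine le_of_mul_le_mul_left ?_ hn
  rw [mul_one_div]
  exact hre.trans ((Complex.re_le_norm _).trans hnorm)

end LowerBound

section Blocks

theorem single_mem_A (hlim : Tendsto (fun n => |c n|) atTop atTop) (hc : ∀ n, c n ≠ 0) (n : ℕ+)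
    (X : Mat n) : (lp.single ∞ n (dPair (hc n) X) : M) ∈ A c := by
  have hunit (k : ℕ+) (hk : n < k) (m : ℕ+) :
      U c k m = 1 ∨ (lp.single ∞ n (dPair (hc n) X) : M) m = 0 := by
    obtain rfl | hm := eq_or_ne m n
    · exact Or.inl (U_of_lt (hc m) hk)
    · exact Or.inr (lp.single_apply_ne _ _ _ hm)
  refine (mem_A_iff hlim).2 ⟨(mem_N_iff hc).2 fun m => ?_, ?_, ?_⟩
  · obtain rfl | hm := eq_or_ne m n
    · rw [lp.single_apply_self]
      rfl
    · rw [lp.single_apply_ne _ _ _ hm, Prod.fst_zero, map_zero]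
  · refine tendsto_const_nhds.congr' ((eventually_gt_atTop n).mono fun k hk => ?_)
    refine lp.ext <| funext fun m => ?_
    rw [lp.infty_coeFn_mul, Pi.mul_apply, approxUnit_apply]
    rcases hunit k hk m with h | h
    · rw [h, one_mul]
    · rw [h, mul_zero]
  · refine tendsto_const_nhds.congr' ((eventually_gt_atTop n).mono fun k hk => ?_)
    refine lp.ext <| funext fun m => ?_
    rw [lp.infty_coeFn_mul, Pi.mul_apply, approxUnit_apply]
    rcases hunit k hk m with h | h
    · rw [h, mul_one]
    · rw [h, zero_mul]

set_option synthInstance.maxHeartbeats 100000 in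
/-- The matrix `xₙ` of an element `((xₙ, dₙ xₙ dₙ⁻¹))ₙ` of `A c`. -/
noncomputable def coord (c : ℕ+ → ℝ) (n : ℕ+) : A c →ₙₐ[ℂ] Mat n where
  toFun a := ((a : M) n).1
  map_smul' _ _ := rfl
  map_zero' := rfl
  map_add' _ _ := rfl
  map_mul' _ _ := rfl

/-- The algebra `A c` as an algebra of sequences of matrices `(xₙ)`. -/
noncomputable def blockSystem (hlim : Tendsto (fun n => |c n|) atTop atTop) (hc : ∀ n, c n ≠ 0) :
    BlockSystem Mat (A c) where
  coord := coord c
  block n X := ⟨lp.single ∞ n (dPair (hc n) X), single_mem_A hlim hc n X⟩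
  coord_block n X m := by
    change ((lp.single ∞ n (dPair (hc n) X) : M) m).1 = _
    obtain rfl | hm := eq_or_ne m n
    · rw [lp.single_apply_self, Pi.single_eq_same]
      rfl
    · rw [lp.single_apply_ne _ _ _ hm, Pi.single_eq_of_ne hm, Prod.fst_zero]
  ext a b h := Subtype.ext <| lp.ext <| funext fun n => by
    rw [(mem_N_iff hc).1 a.2.1 n, (mem_N_iff hc).1 b.2.1 n]
    exact congr_arg _ (h n)

variable (hlim : Tendsto (fun n => |c n|) atTop atTop) (hc : ∀ n, c n ≠ 0)

theorem apply_eq_dPair_coord (a : A c) (n : ℕ+) :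
    (a : M) n = dPair (hc n) ((blockSystem hlim hc).coord n a) :=
  (mem_N_iff hc).1 a.2.1 n

theorem quasiregularTails : (blockSystem hlim hc).QuasiregularTails := fun a => by
  have hfin : {n | ¬ ‖((a : M) n).2‖ < 1}.Finite :=
    cofinite_le_atTop ((tendsto_norm_snd hlim a.2).eventually_lt_const one_pos)
  refine ⟨hfin.toFinset, isQuasiregular_of_isUnit hlim hc _ fun n => ?_⟩
  rw [apply_eq_dPair_coord hlim hc, BlockSystem.coord_sub_sum_block]
  split_ifs with hn
  · rw [map_zero, Prod.snd_zero, add_zero]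
    exact isUnit_one
  · rw [← apply_eq_dPair_coord hlim hc, ← sub_neg_eq_add]
    refine isUnit_one_sub_of_norm_lt_one ?_
    rwa [hfin.mem_toFinset, Set.mem_ofPred_eq, not_not, ← norm_neg] at hn

theorem norm_coord_le (n : ℕ+) (a : A c) : ‖(blockSystem hlim hc).coord n a‖ ≤ ‖a‖ :=
  (norm_fst_le _).trans (lp.norm_apply_le_norm ENNReal.top_ne_zero (a : M) n)

set_option synthInstance.maxHeartbeats 100000 in
theorem norm_sum_block_one_le (s : Finset ℕ+) :
    ‖∑ n ∈ s, (blockSystem hlim hc).block n 1‖ ≤ 1 := by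
  have hle (n : ℕ+) : ‖((∑ m ∈ s, (blockSystem hlim hc).block m 1 : A c) : M) n‖ ≤ 1 := by
    rw [apply_eq_dPair_coord hlim hc, BlockSystem.coord_sum_block]
    split_ifs with hn
    · rw [map_one, norm_one]
    · rw [map_zero, norm_zero]
      exact zero_le_one
  exact lp.norm_le_of_forall_le zero_le_one hle

include hlim hc in
theorem not_isWeaklyCompact : ¬ IsWeaklyCompact (A c) := fun hA => by
  have hzero : Tendsto (fun n => ‖u n 8 * u n 8‖) cofinite (𝓝 0) :=
   BlockSystem.tendsto_norm_coord_mul_self hA (norm_coord_le hlim hc)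
      (norm_sum_block_one_le hlim hc) ⟨_, approxUnit_mem_A hlim hc 8⟩
  have hsmall : ∀ᶠ n in atTop, ‖u n 8 * u n 8‖ < 1 / 2 :=
    atTop_le_cofinite (hzero.eventually_lt_const one_half_pos)
  obtain ⟨n, hn, h8⟩ := (hsmall.and (eventually_ge_atTop 8)).exists
  exact hn.not_ge (half_le_norm_u_mul_u le_rfl h8)

end Blocks

end ShiftAlg

theorem mainTheorem2_general (c : ℕ+ → ℝ) (hlim : Tendsto (fun n => |c n|) atTop atTop)
    (hc : ∀ n, c n ≠ 0) :
    IsClosed (ShiftAlg.A c : Set ShiftAlg.M) ∧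
    (∀ a : ShiftAlg.A c, (quasispectrum ℂ a).Finite ∨
      ∃ l : ℕ → ℂ, Tendsto l atTop (𝓝 0) ∧ quasispectrum ℂ a = insert 0 (Set.range l)) ∧
    BanachAlg.IsSemisimple (ShiftAlg.A c) ∧
    BanachAlg.IsApproximatelyUnital (ShiftAlg.A c) ∧
    BanachAlg.IsModularAnnihilator (ShiftAlg.A c) ∧
    ¬ BanachAlg.IsWeaklyCompact (ShiftAlg.A c) :=
  ⟨ShiftAlg.isClosed_A hlim hc,
    fun a => finite_or_eq_insert_range_of_tendsto (quasispectrum.zero_mem ℂ a)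
      (ShiftAlg.tendsto_coe_quasispectrum hlim hc a),
    (ShiftAlg.blockSystem hlim hc).isSemisimple,
    ShiftAlg.isApproximatelyUnital hlim hc,
    (ShiftAlg.quasiregularTails hlim hc).isModularAnnihilator,
    ShiftAlg.not_isWeaklyCompact hlim hc⟩

theorem mainTheorem2 (c : ℕ+ → ℝ) (hpos : ∀ n, 0 < c n) (hmono : Monotone c)
    (hunb : ¬ BddAbove (Set.range c)) :
    IsClosed (ShiftAlg.A c : Set ShiftAlg.M) ∧
    (∀ a : ShiftAlg.A c, (quasispectrum ℂ a).Finite ∨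
      ∃ l : ℕ → ℂ, Tendsto l atTop (𝓝 0) ∧ quasispectrum ℂ a = insert 0 (Set.range l)) ∧
    BanachAlg.IsSemisimple (ShiftAlg.A c) ∧
    BanachAlg.IsApproximatelyUnital (ShiftAlg.A c) ∧
    BanachAlg.IsModularAnnihilator (ShiftAlg.A c) ∧
    ¬ BanachAlg.IsWeaklyCompact (ShiftAlg.A c) :=
  mainTheorem2_general c
    (tendsto_abs_atTop_atTop.comp <|
      (tendsto_atTop_of_monotone hmono).resolve_right fun ⟨l, hl⟩ =>
        hunb <| bddAbove_range_of_eventually_le (hl.eventually_le_const (lt_add_one l)))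
    fun n => (hpos n).ne'
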